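/- Let $\mathbb T=\mathbb R/2\pi\mathbb Z$, and for $f\in L^2(\mathbb T)$ put $\widehat f(k)=\int_{\mathbb T}f(x)e^{-ikx}\,dx$ and $\|f\|_{H^s}^2=\frac1{2\pi}\sum_{k\in\mathbb Z}(1+k^2)^s|\widehat f(k)|^2$. Let $h=\pi/M$ with an integer $M\ge 1$, and let $\mathbb T_h=\{hj:-M\le j\le M-1\}\cong\mathbb Z/2M\mathbb Z$. For $g:\mathbb T_h\to\mathbb C$ put $\mathcal F_h g(k)=h\sum_{x\in\mathbb T_h}g(x)e^{-ikx}$. Let $(-\Delta)^{\alpha/2}$ be the Fourier multiplier on $\mathbb T$ with symbol $|k|^\alpha$, and let $(-\Delta_h)^{\alpha/2}$ be the multiplier on $\mathbb T_h$ with symbol $\left|\frac2h\sin\frac{hk}2\right|^\alpha$, $-M\le k\le M-1$. Define $$d_hf(x)=\frac1h\int_x^{x+h}f(y)\,dy\quad(x\in\mathbb T_h),\qquad p_hg(x)=g(x_0)+\frac{g(x_0+h)-g(x_0)}h(x-x_0)\quad(x_0\in\mathbb T_h,\ x\in[x_0,x_0+h)).$$ Let $\mu\in\{1,-1\}$. Write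 $S(t)u_0$ for the solution, in $C([0,T];H^{\alpha/2}(\mathbb T))$ and in the integral (Duhamel) sense, of $i\partial_tu=(-\Delta)^{\alpha/2}u+\mu|u|^2u$, $u(0)=u_0$, and write $S_h(t)w_0$ for the continuous solution, in the integral sense, of $i\dot w=(-\Delta_h)^{\alpha/2}w+\mu|w|^2w$ on $\mathbb T_h$, $w(0)=w_0$. Proposition. Let $\alpha\in(1,2]$. There are $T_0>0$ and $K>0$ such that for every $T\in(0,T_0]$ there are $c=c(T,\alpha)>0$ and $h_0>0$ with the following property. For every $\mu\in\{1,-1\}$ and every $h=\pi/M<h_0$ there is $u_0^h\in H^{\alpha/2}(\mathbb T)$ such that 1. $\|u_0^h\|_{H^{\alpha/2}}\le K$; 2. $\widehat{u_0^h}(k)=0$ for every integer $k\ne k_0$, where $k_0$ is the integer nearest to $(Th^2)^{-1/(2+\alpha)}$; 3. the solutions $S(t)u_0^h$ and $S_h(t)d_hu_0^h$ exist on $[0,T]$ and are unique, and $$\|p_hS_h(t)d_hu_0^h-S(t)u_0^h\|_{L^\infty([0,T];L^2(\mathbb T))}\ \ge\ c\,h^{\frac{\alpha}{2+\alpha}}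 .$$ -/

import Mathlib

open MeasureTheory Set Filter Topology
open scoped Real ENNReal

noncomputable section

namespace FDNLS

instance factTwoPiPos : Fact (0 < 2 * π) := ⟨Real.two_pi_pos⟩

/-- The torus `𝕋 = ℝ / 2πℤ`. -/
abbrev Torus : Type := AddCircle (2 * π)

/-- Square-integrable functions on the torus.  The measure used by this type is the normalised
one (mass `1`), for which Mathlib has the Fourier basis; it has the same null sets and the same
square-integrable functions as Lebesgue measure `dx` (mass `2π`).  All norms below that enter
the result are taken with respect to `dx`. -/
abbrev L2 : Type := Lp ℂ 2 (AddCircle.haarAddCircle (T := 2 * π))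

/-- The Fourier coefficient `f̂(k) = ∫_𝕋 f(x) e^{-ikx} dx`, where
`fourierCoeff f k = (2π)⁻¹ ∫_𝕋 f(x) e^{-ikx} dx`. -/
def fourierHat (f : L2) (k : ℤ) : ℂ := 2 * π * fourierCoeff f k

/-- Membership in `H^s(𝕋)`, `s ≥ 0`. -/
def MemSobolev (s : ℝ) (f : L2) : Prop :=
  Summable fun k : ℤ => (1 + (k : ℝ) ^ 2) ^ s * ‖fourierHat f k‖ ^ 2

/-- The norm `‖f‖_{H^s}² = (2π)⁻¹ ∑_k ⟨k⟩^{2s} |f̂(k)|²`, for `f ∈ H^s(𝕋)`. -/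
def sobolevNorm (s : ℝ) (f : L2) : ℝ :=
  √((2 * π)⁻¹ * ∑' k : ℤ, (1 + (k : ℝ) ^ 2) ^ s * ‖fourierHat f k‖ ^ 2)

/-! ### The fractional NLS on the torus -/

lemma memlp_mul_phase (θ : ℤ → ℝ) (a : lp (fun _ : ℤ => ℂ) 2) :
    Memℓp (fun k => Complex.exp (Complex.I * θ k) * a k) 2 := by
  refine (lp.memℓp a).mono' fun k => le_of_eq ?_
  rw [norm_mul, Complex.norm_exp_I_mul_ofReal, one_mul]

/-- The propagator `U(t) = e^{-it(-Δ)^{α/2}}`: the Fourier multiplier `e^{-it|k|^α}`. -/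
def propagator (α t : ℝ) (f : L2) : L2 :=
  fourierBasis.repr.symm
    ⟨fun k => Complex.exp (Complex.I * ((-(t * |(k : ℝ)| ^ α) : ℝ) : ℂ)) * fourierBasis.repr f k,
      memlp_mul_phase (fun k => -(t * |(k : ℝ)| ^ α)) (fourierBasis.repr f)⟩

lemma fourierHat_propagator (α t : ℝ) (f : L2) (k : ℤ) :
    fourierHat (propagator α t f) k =
      Complex.exp (Complex.I * ((-(t * |(k : ℝ)| ^ α) : ℝ) : ℂ)) * fourierHat f k := by
  simp only [fourierHat, ← fourierBasis_repr, propagator, LinearIsometryEquiv.apply_symm_apply]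
  ring

open Classical in
/-- The nonlinearity `|f|² f` as an element of `L²(𝕋)`.  It is square-integrable whenever `f` is
bounded, in particular for `f ∈ H^s(𝕋)` with `s > 1/2`; otherwise the value is not used. -/
def cubic (f : L2) : L2 :=
  if hf : MemLp (fun x : Torus => ((‖f x‖ ^ 2 : ℝ) : ℂ) * f x) 2 AddCircle.haarAddCircle then
    hf.toLp _
  else 0

/-- `u` is a solution on `[0,T]`, in the class `C([0,T]; H^{α/2}(𝕋))`, of
`i ∂ₜu = (-Δ)^{α/2} u + μ |u|² u`, `u(0) = u₀`, in the integral (Duhamel) form; the integral is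
a Bochner integral in `L²(𝕋)`. -/
structure IsSolution (α μ T : ℝ) (u₀ : L2) (u : ℝ → L2) : Prop where
  mem_sobolev : ∀ t ∈ Icc 0 T, MemSobolev (α / 2) (u t)
  continuous_sobolev : ∀ t ∈ Icc 0 T,
    Tendsto (fun τ => sobolevNorm (α / 2) (u τ - u t)) (𝓝[Icc 0 T] t) (𝓝 0)
  duhamel : ∀ t ∈ Icc 0 T,
    u t = propagator α t u₀
      - (Complex.I * μ) • ∫ τ in (0 : ℝ)..t, propagator α (t - τ) (cubic (u τ))

/-! ### The lattice -/

/-- The mesh size `h = π / M`. -/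
def mesh (M : ℕ) : ℝ := π / M

/-- Complex functions on the lattice `𝕋_h = {h j} ≅ ℤ / 2Mℤ`, `h = π / M`: the index `j`
stands for the lattice point `h j` modulo `2π`. -/
abbrev LatticeFun (M : ℕ) : Type := ZMod (2 * M) → ℂ

/-- The character `e^{ikx}` at the lattice point `x = h j`. -/
def latticeChar (M : ℕ) (k : ℤ) (j : ZMod (2 * M)) : ℂ :=
  Complex.exp (Complex.I * ((k * (mesh M * j.val) : ℝ) : ℂ))

/-- `𝓕_h[g](k) = h ∑_{x ∈ 𝕋_h} g(x) e^{-ikx}`. -/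
def latticeFourier (M : ℕ) [NeZero M] (g : LatticeFun M) (k : ℤ) : ℂ :=
  mesh M * ∑ j : ZMod (2 * M), g j * latticeChar M (-k) j

/-- The symbol `σ_h(k) = |(2/h) sin(hk/2)|^α` of `(-Δ_h)^{α/2}`. -/
def latticeSymbol (α : ℝ) (M : ℕ) (k : ℤ) : ℝ :=
  |2 / mesh M * Real.sin (mesh M * k / 2)| ^ α

/-- The propagator `U_h(t) = e^{-it(-Δ_h)^{α/2}} = 𝓕_h⁻¹ e^{-itσ_h(k)} 𝓕_h`, where
`𝓕_h⁻¹[G](x) = (2π)⁻¹ ∑_{-M ≤ k < M} G(k) e^{ikx}`. -/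
def latticePropagator (α : ℝ) (M : ℕ) [NeZero M] (t : ℝ) (g : LatticeFun M) : LatticeFun M :=
  fun j => (2 * π : ℂ)⁻¹ * ∑ k ∈ Finset.Ico (-(M : ℤ)) M,
    Complex.exp (Complex.I * ((-(t * latticeSymbol α M k) : ℝ) : ℂ))
      * latticeFourier M g k * latticeChar M k j

/-- `w` is a solution on `[0,T]`, continuous in time, of the lattice equation
`i ẇ = (-Δ_h)^{α/2} w + μ |w|² w`, `w(0) = w₀`, in the integral (Duhamel) form. -/
structure IsLatticeSolution (α μ T : ℝ) (M : ℕ) [NeZero M] (w₀ : LatticeFun M)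
    (w : ℝ → LatticeFun M) : Prop where
  continuousOn : ContinuousOn w (Icc 0 T)
  duhamel : ∀ t ∈ Icc 0 T,
    w t = latticePropagator α M t w₀
      - (Complex.I * μ) • ∫ τ in (0 : ℝ)..t,
          latticePropagator α M (t - τ) (fun j => ((‖w τ j‖ ^ 2 : ℝ) : ℂ) * w τ j)

/-- Discretization: `(d_h f)(x) = h⁻¹ ∫_x^{x+h} f(y) dy` for `x ∈ 𝕋_h`. -/
def discretize (M : ℕ) (f : L2) : LatticeFun M :=
  fun j => (mesh M : ℂ)⁻¹ * ∫ y in (mesh M * j.val)..(mesh M * j.val + mesh M), f (y : Torus)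

/-- Linear interpolation: if `y ∈ [-π,π)` represents the point of the torus and `n = ⌊y/h⌋`, so
that `x₀ = h n` and `y ∈ [x₀, x₀ + h)`, the value is
`g(x₀) + h⁻¹ (g(x₀ + h) - g(x₀)) (y - x₀)`. -/
def interpolate (M : ℕ) (g : LatticeFun M) (x : Torus) : ℂ :=
  let y : ℝ := AddCircle.equivIco (2 * π) (-π) x
  let n : ℤ := ⌊y / mesh M⌋
  g (n : ZMod (2 * M))
    + (g ((n + 1 : ℤ) : ZMod (2 * M)) - g (n : ZMod (2 * M))) / mesh M * ((y - mesh M * n : ℝ) : ℂ)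

/-- The norm `‖p_h w - u‖_{L^∞([0,T]; L²(𝕋))}`, with Lebesgue measure on `[0,T]` and on the torus
(of mass `2π`). -/
def errorNorm (T : ℝ) (M : ℕ) (w : ℝ → LatticeFun M) (u : ℝ → L2) : ℝ≥0∞ :=
  essSup (fun t => eLpNorm (fun x : Torus => interpolate M (w t) x - u t x) 2 volume)
    (volume.restrict (Icc 0 T))

end FDNLS

end

/-! A single plane wave `A e^{iqx}` already shows the loss. Plane waves are exact solutions of both
equations. On the torus the phase is `-t(|q|^α + μA²)`. On the lattice, averaging multiplies the
amplitude by a factor `γ` with `|γ - 1| ≤ qh`, and the phase becomes `-t(σ_h(q) + μ|Aγ|²)`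
(`isSolution_planeWave`, `isLatticeSolution_planeWave`).

The symbols differ by an amount comparable to `q^{2+α} h²` (`symbol_sub_latticeSymbol_bounds`). For
`q` nearest to `κ = (Th²)^{-1/(2+α)}` this gap times `T` is of order one, so the two phases stay
separated on `[T/2, T]` (`phase_bounds`). Averaging, interpolation and the nonlinear phase shift
contribute only relative errors `O(qh)`, which tend to zero with `h`. The error is therefore at
least a multiple of `A` on the whole torus.

Normalising the `H^{α/2}` norm forces `A = ⟨q⟩^{-α/2}`, which is comparable to `κ^{-α/2} =
T^{α/(2(2+α))} h^{α/(2+α)}` (`amplitude_lower_bound`): the claimed rate.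

Existence is thus explicit. Uniqueness is Grönwall's inequality applied to Duhamel's formula
(`duhamel_unique`), in `L²` on the torus with sup bounds from Sobolev embedding, and in the sup norm
on the lattice. -/

namespace FDNLS

/-! ### Duhamel's formula in an abstract normed space -/

/-- Integral form of Grönwall's inequality with vanishing initial value. -/
lemma eq_zero_of_le_mul_integral {φ : ℝ → ℝ} {T L : ℝ} (hT : 0 ≤ T)
    (hc : ContinuousOn φ (Icc 0 T)) (hφ : ∀ t ∈ Icc 0 T, 0 ≤ φ t)
    (hle : ∀ t ∈ Icc 0 T, φ t ≤ L * ∫ τ in (0 : ℝ)..t, φ τ) :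
    ∀ t ∈ Icc 0 T, φ t = 0 := by
  -- A continuous extension to `ℝ` makes the primitive differentiable at the endpoints too; Grönwall
  -- is applied to that primitive.
  set ψ : ℝ → ℝ := IccExtend hT ((Icc 0 T).domRestrict φ) with hψ
  have hψc : Continuous ψ := (continuousOn_iff_continuous_domRestrict.1 hc).Icc_extend'
  have hψeq : ∀ t ∈ Icc 0 T, ψ t = φ t := fun t ht => by
    simp [hψ, IccExtend_of_mem hT _ ht, domRestrict_apply]
  have hint : ∀ t ∈ Icc 0 T, ∫ τ in (0 : ℝ)..t, φ τ = ∫ τ in (0 : ℝ)..t, ψ τ := fun t ht => by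
    refine intervalIntegral.integral_congr fun τ hτ => ?_
    rw [uIcc_of_le ht.1] at hτ
    exact (hψeq τ ⟨hτ.1, hτ.2.trans ht.2⟩).symm
  have hder : ∀ t, HasDerivAt (fun t => ∫ τ in (0 : ℝ)..t, ψ τ) (ψ t) t := fun t =>
    hψc.integral_hasStrictDerivAt 0 t |>.hasDerivAt
  have hnn : ∀ t ∈ Icc 0 T, 0 ≤ ∫ τ in (0 : ℝ)..t, ψ τ := fun t ht =>
    intervalIntegral.integral_nonneg ht.1 fun τ hτ => by
      have hmem : τ ∈ Icc 0 T := ⟨hτ.1, hτ.2.trans ht.2⟩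
      rw [hψeq τ hmem]; exact hφ τ hmem
  have hbound := norm_le_gronwallBound_of_norm_deriv_right_le (δ := 0) (K := L) (ε := 0)
    (f := fun t => ∫ τ in (0 : ℝ)..t, ψ τ) (f' := ψ) (a := 0) (b := T)
    (fun t _ => (hder t).continuousAt.continuousWithinAt)
    (fun t _ => (hder t).hasDerivWithinAt) (by simp) (fun t ht => by
      have ht' := Ico_subset_Icc_self ht
      rw [Real.norm_of_nonneg (hnn t ht'), hψeq t ht', Real.norm_of_nonneg (hφ t ht'), add_zero,
        ← hint t ht']
      exact hle t ht')
  intro t ht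
  have h0 : ∫ τ in (0 : ℝ)..t, ψ τ = 0 := by
    have := hbound t ht
    rw [gronwallBound_ε0_δ0] at this
    exact norm_le_zero_iff.1 this
  refine le_antisymm ?_ (hφ t ht)
  have := hle t ht
  rwa [hint t ht, h0, mul_zero] at this

/-- Uniqueness for Duhamel's formula with a Lipschitz nonlinearity. -/
lemma duhamel_unique {E : Type*} [NormedAddCommGroup E] [NormedSpace ℂ E]
    {U : ℝ → E → E} {N : E → E} {u v : ℝ → E} {u₀ : E} {c : ℂ} {T C L : ℝ}
    (hU : ∀ t f g, ‖U t f - U t g‖ ≤ C * ‖f - g‖)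
    (hUc : ∀ t ∈ Icc 0 T, ∀ g : ℝ → E, ContinuousOn g (Icc 0 t) →
      ContinuousOn (fun τ => U (t - τ) (g τ)) (Icc 0 t)) (hC : 0 ≤ C)
    (huc : ContinuousOn u (Icc 0 T)) (hvc : ContinuousOn v (Icc 0 T))
    (hNu : ContinuousOn (fun τ => N (u τ)) (Icc 0 T))
    (hNv : ContinuousOn (fun τ => N (v τ)) (Icc 0 T))
    (hN : ∀ t ∈ Icc 0 T, ‖N (u t) - N (v t)‖ ≤ L * ‖u t - v t‖)
    (hu : ∀ t ∈ Icc 0 T, u t = U t u₀ - c • ∫ τ in (0 : ℝ)..t, U (t - τ) (N (u τ)))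
    (hv : ∀ t ∈ Icc 0 T, v t = U t u₀ - c • ∫ τ in (0 : ℝ)..t, U (t - τ) (N (v τ))) :
    EqOn u v (Icc 0 T) := by
  intro t ht
  have hdc : ContinuousOn (fun t => ‖u t - v t‖) (Icc 0 T) := (huc.sub hvc).norm
  refine sub_eq_zero.1 (norm_eq_zero.1 (eq_zero_of_le_mul_integral (φ := fun t => ‖u t - v t‖)
    (L := ‖c‖ * (C * L)) (ht.1.trans ht.2) hdc (fun _ _ => norm_nonneg _) (fun s hs => ?_) t ht))
  have hsub : Icc 0 s ⊆ Icc 0 T := Icc_subset_Icc_right hs.2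
  -- Integrability of both integrands is what allows the two Duhamel integrals to be subtracted
  -- under one sign.
  have hI : ∀ {g : ℝ → E}, ContinuousOn g (Icc 0 T) →
      IntervalIntegrable (fun τ => U (s - τ) (g τ)) volume 0 s := fun hg =>
    ContinuousOn.intervalIntegrable_of_Icc hs.1 (hUc s hs _ (hg.mono hsub))
  have hdiff : u s - v s =
      -(c • ∫ τ in (0 : ℝ)..s, (U (s - τ) (N (u τ)) - U (s - τ) (N (v τ)))) := by
    rw [intervalIntegral.integral_sub (hI hNu) (hI hNv)]
    nth_rewrite 1 [hu s hs, hv s hs]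
    rw [smul_sub]; abel
  show ‖u s - v s‖ ≤ _
  rw [hdiff, norm_neg, norm_smul, mul_assoc]
  refine mul_le_mul_of_nonneg_left ?_ (norm_nonneg _)
  rw [← intervalIntegral.integral_const_mul]
  refine intervalIntegral.norm_integral_le_of_norm_le hs.1 (ae_of_all _ fun τ hτ => ?_)
    ((continuousOn_const.mul (hdc.mono hsub)).intervalIntegrable_of_Icc hs.1)
  rw [mul_assoc]
  exact (hU _ _ _).trans (mul_le_mul_of_nonneg_left (hN τ (hsub (Ioc_subset_Icc_self hτ))) hC)

/-- The phase factor of a plane wave satisfies the scalar Duhamel formula. -/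
lemma planeWave_duhamel {E : Type*} [NormedAddCommGroup E] [NormedSpace ℂ E] [CompleteSpace E]
    (e : E) (a : ℂ) (ω μ t : ℝ) :
    (a * Complex.exp (Complex.I * ((-(t * (ω + μ * ‖a‖ ^ 2)) : ℝ) : ℂ))) • e =
      (a * Complex.exp (Complex.I * ((-(t * ω) : ℝ) : ℂ))) • e
      - (Complex.I * μ) • ∫ τ in (0 : ℝ)..t,
        (((‖a‖ ^ 2 : ℝ) : ℂ) * a *
          Complex.exp (Complex.I * ((-(τ * (ω + μ * ‖a‖ ^ 2)) : ℝ) : ℂ)) *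
            Complex.exp (Complex.I * ((-((t - τ) * ω) : ℝ) : ℂ))) • e := by
  rw [intervalIntegral.integral_smul_const, smul_smul, ← sub_smul]
  congr 1
  set b : ℂ := -(Complex.I * μ * (‖a‖ ^ 2 : ℝ)) with hb
  -- Keeping the factor `b` inside avoids dividing by it, so `a = 0` or `μ = 0` needs no separate
  -- case.
  have hint : ∫ τ in (0 : ℝ)..t, b * Complex.exp (b * τ) = Complex.exp (b * t) - 1 := by
    have hd : ∀ τ ∈ uIcc 0 t, HasDerivAt (fun τ : ℝ => Complex.exp (b * τ))
        (b * Complex.exp (b * τ)) τ := fun τ _ => by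
      have := (((hasDerivAt_id (τ : ℂ)).const_mul b).cexp).comp_ofReal
      simpa [mul_comm] using this
    rw [intervalIntegral.integral_eq_sub_of_hasDerivAt hd
      (Continuous.intervalIntegrable (by fun_prop) _ _)]
    simp
  -- The linear phases over `[0, τ]` and `[τ, t]` combine to one independent of `τ`; only `e^{bτ}`
  -- is left to integrate.
  have hEq : ∀ τ : ℝ, ((‖a‖ ^ 2 : ℝ) : ℂ) * a *
      Complex.exp (Complex.I * ((-(τ * (ω + μ * ‖a‖ ^ 2)) : ℝ) : ℂ)) *
        Complex.exp (Complex.I * ((-((t - τ) * ω) : ℝ) : ℂ)) =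
      (((‖a‖ ^ 2 : ℝ) : ℂ) * a * Complex.exp (Complex.I * ((-(t * ω) : ℝ) : ℂ))) *
        Complex.exp (b * τ) := fun τ => by
    rw [mul_assoc, mul_assoc _ (Complex.exp _) (Complex.exp _), ← Complex.exp_add,
      ← Complex.exp_add]
    congr 2
    rw [hb]; push_cast; ring
  have hexp : Complex.exp (Complex.I * ((-(t * (ω + μ * ‖a‖ ^ 2)) : ℝ) : ℂ)) =
      Complex.exp (Complex.I * ((-(t * ω) : ℝ) : ℂ)) * Complex.exp (b * t) := by
    rw [← Complex.exp_add]; congr 1; rw [hb]; push_cast; ring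
  simp_rw [hEq]
  rw [intervalIntegral.integral_const_mul, hexp]
  rw [intervalIntegral.integral_const_mul] at hint
  have : Complex.exp (b * t) = 1 + b * ∫ τ in (0 : ℝ)..t, Complex.exp (b * τ) := by
    rw [hint]; ring
  rw [this, hb]
  ring

/-- The map `z ↦ |z|² z` is Lipschitz on bounded sets. -/
lemma norm_cubic_sub_le {z w : ℂ} {R : ℝ} (hz : ‖z‖ ≤ R) (hw : ‖w‖ ≤ R) :
    ‖((‖z‖ ^ 2 : ℝ) : ℂ) * z - ((‖w‖ ^ 2 : ℝ) : ℂ) * w‖ ≤ 3 * R ^ 2 * ‖z - w‖ := by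
  have hR : 0 ≤ R := (norm_nonneg z).trans hz
  have hid : ((‖z‖ ^ 2 : ℝ) : ℂ) * z - ((‖w‖ ^ 2 : ℝ) : ℂ) * w =
      ((‖z‖ ^ 2 : ℝ) : ℂ) * (z - w) + (((‖z‖ - ‖w‖) * (‖z‖ + ‖w‖) : ℝ) : ℂ) * w := by
    push_cast; ring
  rw [hid]
  refine (norm_add_le _ _).trans ?_
  rw [norm_mul, norm_mul, Complex.norm_real, Complex.norm_real, norm_mul,
    Real.norm_of_nonneg (sq_nonneg ‖z‖), Real.norm_of_nonneg (by positivity : 0 ≤ ‖z‖ + ‖w‖)]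
  have h1 : ‖‖z‖ - ‖w‖‖ ≤ ‖z - w‖ := abs_norm_sub_norm_le z w
  have h2 : ‖z‖ ^ 2 * ‖z - w‖ ≤ R ^ 2 * ‖z - w‖ := by gcongr
  have h3 : ‖‖z‖ - ‖w‖‖ * (‖z‖ + ‖w‖) * ‖w‖ ≤ ‖z - w‖ * (R + R) * R := by gcongr
  linarith

/-! ### Fourier coefficients and the propagator on the torus -/

lemma fourierHat_eq_repr (f : L2) (k : ℤ) : fourierHat f k = 2 * π * fourierBasis.repr f k := by
  rw [fourierHat, fourierBasis_repr]

lemma fourierHat_sub (f g : L2) (k : ℤ) : fourierHat (f - g) k = fourierHat f k - fourierHat g k := by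
  simp only [fourierHat_eq_repr, map_sub, lp.coeFn_sub, Pi.sub_apply]; ring

lemma repr_propagator (α t : ℝ) (f : L2) (k : ℤ) :
    fourierBasis.repr (propagator α t f) k =
      Complex.exp (Complex.I * ((-(t * |(k : ℝ)| ^ α) : ℝ) : ℂ)) * fourierBasis.repr f k := by
  simp only [propagator, LinearIsometryEquiv.apply_symm_apply]

lemma norm_sq_eq_tsum_repr (f : L2) : ‖f‖ ^ 2 = ∑' k, ‖fourierBasis.repr f k‖ ^ 2 := by
  rw [← fourierBasis.repr.norm_map f]
  have := lp.norm_rpow_eq_tsum (p := 2) (by norm_num) (fourierBasis.repr f)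
  simpa using this

lemma summable_sq_repr (f : L2) : Summable fun k => ‖fourierBasis.repr f k‖ ^ 2 := by
  have := (lp.memℓp (fourierBasis.repr f)).summable (by norm_num)
  simpa using this

lemma L2_ext_repr {f g : L2} (h : ∀ k, fourierBasis.repr f k = fourierBasis.repr g k) : f = g :=
  fourierBasis.repr.injective (lp.ext (funext h))

lemma norm_propagator (α t : ℝ) (f : L2) : ‖propagator α t f‖ = ‖f‖ := by
  rw [← sq_eq_sq₀ (norm_nonneg _) (norm_nonneg _), norm_sq_eq_tsum_repr, norm_sq_eq_tsum_repr]
  simp only [repr_propagator, norm_mul, Complex.norm_exp_I_mul_ofReal, one_mul]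

lemma propagator_sub (α t : ℝ) (f g : L2) :
    propagator α t (f - g) = propagator α t f - propagator α t g := by
  refine L2_ext_repr fun k => ?_
  simp only [map_sub, lp.coeFn_sub, Pi.sub_apply, repr_propagator]; ring

/-- The propagator is strongly continuous. -/
lemma continuous_propagator (α : ℝ) (f : L2) : Continuous fun t => propagator α t f := by
  refine continuous_iff_continuousAt.2 fun s => ?_
  -- By Parseval this sum is the squared distance; two phases differ by at most 2, hence the
  -- summable majorant with factor `4`.
  have hsum : Continuous fun t : ℝ => ∑' k : ℤ,
      ‖fourierBasis.repr (propagator α t f - propagator α s f) k‖ ^ 2 := by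
    refine continuous_tsum (u := fun k => 4 * ‖fourierBasis.repr f k‖ ^ 2) (fun k => ?_)
      ((summable_sq_repr f).mul_left 4) (fun k t => ?_)
    · simp only [map_sub, lp.coeFn_sub, Pi.sub_apply, repr_propagator]
      fun_prop
    · simp only [map_sub, lp.coeFn_sub, Pi.sub_apply, repr_propagator]
      rw [Real.norm_of_nonneg (sq_nonneg _), ← sub_mul, norm_mul, mul_pow]
      have h := norm_sub_le (Complex.exp (Complex.I * ((-(t * |(k : ℝ)| ^ α) : ℝ) : ℂ)))
        (Complex.exp (Complex.I * ((-(s * |(k : ℝ)| ^ α) : ℝ) : ℂ)))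
      rw [Complex.norm_exp_I_mul_ofReal, Complex.norm_exp_I_mul_ofReal] at h
      refine mul_le_mul_of_nonneg_right ?_ (sq_nonneg _)
      refine (pow_le_pow_left₀ (norm_nonneg _) h 2).trans (by norm_num)
  simp_rw [← norm_sq_eq_tsum_repr] at hsum
  rw [ContinuousAt, tendsto_iff_norm_sub_tendsto_zero]
  have h := ((hsum.sqrt).tendsto s)
  simpa [Real.sqrt_sq (norm_nonneg _)] using h

/-- Strong continuity suffices: since the propagators are isometries, moving `g` costs `‖g σ - g
τ‖`, and what remains moves the time on the fixed vector `g τ`. -/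
lemma continuousOn_propagator_comp {α t : ℝ} {g : ℝ → L2} {s : Set ℝ} (hg : ContinuousOn g s) :
    ContinuousOn (fun τ => propagator α (t - τ) (g τ)) s := by
  intro τ hτ
  rw [ContinuousWithinAt, tendsto_iff_norm_sub_tendsto_zero]
  have h1 : Tendsto (fun σ => ‖g σ - g τ‖) (𝓝[s] τ) (𝓝 0) :=
    tendsto_iff_norm_sub_tendsto_zero.1 (hg τ hτ)
  have h2 : Tendsto (fun σ => ‖propagator α (t - σ) (g τ) - propagator α (t - τ) (g τ)‖)
      (𝓝[s] τ) (𝓝 0) :=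
    tendsto_iff_norm_sub_tendsto_zero.1 ((((continuous_propagator α (g τ)).comp
      (continuous_const.sub continuous_id)).tendsto τ).mono_left nhdsWithin_le_nhds)
  refine squeeze_zero (fun _ => norm_nonneg _) (fun σ => ?_) (by simpa using h1.add h2)
  rw [← norm_propagator α (t - σ) (g σ - g τ), propagator_sub]
  exact norm_sub_le_norm_sub_add_norm_sub _ _ _

/-! ### Sobolev embedding -/

/-- The `ℓ¹` norm of the Fourier coefficients. -/
noncomputable def wienerNorm (f : L2) : ℝ := ∑' k, ‖fourierBasis.repr f k‖

/-- The Fourier series converges absolutely in `C(𝕋)`. By uniqueness of `L²` limits its sum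
represents `f`, and its sup norm is at most the sum of the norms. -/
lemma ae_norm_le_wienerNorm {f : L2} (hf : Summable fun k => ‖fourierBasis.repr f k‖) :
    ∀ᵐ x ∂(AddCircle.haarAddCircle (T := 2 * π)), ‖f x‖ ≤ wienerNorm f := by
  have hnorm : ∀ k, ‖fourierBasis.repr f k • (fourier k : C(Torus, ℂ))‖ =
      ‖fourierBasis.repr f k‖ := fun k => by rw [norm_smul, fourier_norm, mul_one]
  have hs : Summable fun k => fourierBasis.repr f k • (fourier k : C(Torus, ℂ)) :=
    Summable.of_norm (by simpa only [hnorm] using hf)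
  set g : C(Torus, ℂ) := ∑' k, fourierBasis.repr f k • (fourier k : C(Torus, ℂ)) with hg
  have hgn : ‖g‖ ≤ wienerNorm f := by
    refine (norm_tsum_le_tsum_norm (by simpa only [hnorm] using hf)).trans ?_
    simp only [hnorm, wienerNorm, le_refl]
  have h1 := hs.hasSum.mapL (ContinuousMap.toLp (E := ℂ) 2 AddCircle.haarAddCircle ℂ)
  have h2 := hasSum_fourier_series_L2 f
  simp only [map_smul] at h1
  simp only [← fourierBasis_repr] at h2
  have hfg : f = ContinuousMap.toLp (E := ℂ) 2 AddCircle.haarAddCircle ℂ g := h2.unique h1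
  have hae := ContinuousMap.coeFn_toLp (p := 2) (𝕜 := ℂ)
    (AddCircle.haarAddCircle (T := 2 * π)) g
  rw [← hfg] at hae
  filter_upwards [hae] with x hx
  rw [hx]
  exact (g.norm_coe_le_norm x).trans hgn

lemma summable_one_add_sq_rpow_neg {s : ℝ} (hs : 1 / 2 < s) :
    Summable fun k : ℤ => (1 + (k : ℝ) ^ 2) ^ (-s) := by
  refine Summable.of_norm_bounded_eventually (g := fun k : ℤ => |(k : ℝ)| ^ (-(2 * s)))
    (Real.summable_abs_int_rpow (by linarith)) ?_
  -- At `k = 0` the comparison fails, because `0` to a nonzero power is `0`.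
  filter_upwards [(Set.finite_singleton (0 : ℤ)).compl_mem_cofinite] with k hk
  have hk0 : 0 < |(k : ℝ)| := abs_pos.2 (Int.cast_ne_zero.2 hk)
  rw [Real.norm_of_nonneg (by positivity), show -(2 * s) = 2 * -s by ring,
    Real.rpow_mul hk0.le, Real.rpow_two, sq_abs]
  refine Real.rpow_le_rpow_of_nonpos (by rw [← sq_abs]; positivity) (by linarith) (by linarith)

/-- For `s > 1/2` the `ℓ¹` norm of the Fourier coefficients is controlled by the `H^s` norm. -/
lemma exists_wienerNorm_le {s : ℝ} (hs : 1 / 2 < s) :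
    ∃ C, ∀ f : L2, MemSobolev s f →
      (Summable fun k => ‖fourierBasis.repr f k‖) ∧ wienerNorm f ≤ C * sobolevNorm s f := by
  -- Cauchy–Schwarz with weights `⟨k⟩^{∓s}`: `√(2π)` undoes the normalisation of `sobolevNorm`, and
  -- `2π` is the ratio of `fourierHat` to the basis coefficient.
  refine ⟨√(2 * π) * √(∑' k : ℤ, (1 + (k : ℝ) ^ 2) ^ (-s)) / (2 * π), fun f hf => ?_⟩
  have hpos : ∀ k : ℤ, (0 : ℝ) < 1 + (k : ℝ) ^ 2 := fun k => by positivity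
  have hw1 : ∀ k : ℤ, ((1 + (k : ℝ) ^ 2) ^ (-(s / 2))) ^ (2 : ℝ) = (1 + (k : ℝ) ^ 2) ^ (-s) :=
    fun k => by rw [← Real.rpow_mul (hpos k).le]; congr 1; ring
  have hw2 : ∀ k : ℤ, ((1 + (k : ℝ) ^ 2) ^ (s / 2) * ‖fourierHat f k‖) ^ (2 : ℝ) =
      (1 + (k : ℝ) ^ 2) ^ s * ‖fourierHat f k‖ ^ 2 := fun k => by
    rw [Real.mul_rpow (by positivity) (norm_nonneg _), ← Real.rpow_mul (hpos k).le, Real.rpow_two]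
    congr 2; ring
  have hprod : ∀ k : ℤ, (1 + (k : ℝ) ^ 2) ^ (-(s / 2)) *
      ((1 + (k : ℝ) ^ 2) ^ (s / 2) * ‖fourierHat f k‖) = 2 * π * ‖fourierBasis.repr f k‖ :=
    fun k => by
      rw [← mul_assoc, ← Real.rpow_add (hpos k), neg_add_cancel, Real.rpow_zero, one_mul,
        fourierHat_eq_repr, norm_mul, norm_mul, Complex.norm_real, Real.norm_of_nonneg Real.pi_nonneg]
      simp
  have hCS := Real.summable_and_inner_le_Lp_mul_Lq_tsum_of_nonneg Real.HolderConjugate.two_two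
    (f := fun k : ℤ => (1 + (k : ℝ) ^ 2) ^ (-(s / 2)))
    (g := fun k : ℤ => (1 + (k : ℝ) ^ 2) ^ (s / 2) * ‖fourierHat f k‖)
    (fun k => (Real.rpow_pos_of_pos (hpos k) _).le) (fun k => by positivity)
    (by simp only [hw1]; exact summable_one_add_sq_rpow_neg hs) (by simp only [hw2]; exact hf)
  simp only [hw1, hw2, hprod, ← Real.sqrt_eq_rpow] at hCS
  refine ⟨(summable_mul_left_iff (by positivity)).1 hCS.1, ?_⟩
  rw [tsum_mul_left] at hCS
  have hsob : √(∑' k : ℤ, (1 + (k : ℝ) ^ 2) ^ s * ‖fourierHat f k‖ ^ 2) =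
      √(2 * π) * sobolevNorm s f := by
    rw [sobolevNorm, ← Real.sqrt_mul (by positivity), mul_inv_cancel_left₀ (by positivity)]
  rw [hsob] at hCS
  rw [div_mul_eq_mul_div, le_div_iff₀ (by positivity), wienerNorm]
  linarith [hCS.2]

lemma MemSobolev.sub {s : ℝ} {f g : L2} (hf : MemSobolev s f) (hg : MemSobolev s g) :
    MemSobolev s (f - g) := by
  refine Summable.of_nonneg_of_le (fun k => by positivity) (fun k => ?_)
    ((Summable.add hf hg).mul_left 2)
  rw [fourierHat_sub, ← mul_add, ← mul_assoc, mul_comm 2, mul_assoc]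
  refine mul_le_mul_of_nonneg_left ?_ (by positivity)
  have h := norm_sub_le (fourierHat f k) (fourierHat g k)
  nlinarith [norm_nonneg (fourierHat f k - fourierHat g k),
    sq_nonneg (‖fourierHat f k‖ - ‖fourierHat g k‖)]

lemma norm_le_wienerNorm {f : L2} (hf : Summable fun k => ‖fourierBasis.repr f k‖) :
    ‖f‖ ≤ wienerNorm f := by
  have h := Lp.norm_le_of_ae_bound (p := 2) (f := f) (tsum_nonneg fun _ => norm_nonneg _)
    (ae_norm_le_wienerNorm hf)
  rw [show measureUnivNNReal (AddCircle.haarAddCircle (T := 2 * π)) = 1 from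
    NNReal.coe_injective (by simp [measureUnivNNReal])] at h
  simpa [wienerNorm] using h

lemma abs_wienerNorm_sub_le {f g : L2} (hf : Summable fun k => ‖fourierBasis.repr f k‖)
    (hg : Summable fun k => ‖fourierBasis.repr g k‖)
    (hfg : Summable fun k => ‖fourierBasis.repr (f - g) k‖) :
    |wienerNorm f - wienerNorm g| ≤ wienerNorm (f - g) := by
  rw [wienerNorm, wienerNorm, ← hf.tsum_sub hg, ← Real.norm_eq_abs]
  refine (norm_tsum_le_tsum_norm ((hf.sub hg).norm)).trans ?_
  refine Summable.tsum_le_tsum (fun k => ?_) (hf.sub hg).norm hfg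
  simp only [map_sub, lp.coeFn_sub, Pi.sub_apply]
  exact abs_norm_sub_norm_le _ _

/-- A curve in `C([0,T]; H^s)`, `s > 1/2`, is continuous in `L²` and uniformly bounded. -/
lemma continuousOn_and_bounded_of_sobolev {s T : ℝ} (hs : 1 / 2 < s) {u : ℝ → L2}
    (hmem : ∀ t ∈ Icc 0 T, MemSobolev s (u t))
    (hcont : ∀ t ∈ Icc 0 T,
      Tendsto (fun τ => sobolevNorm s (u τ - u t)) (𝓝[Icc 0 T] t) (𝓝 0)) :
    ContinuousOn u (Icc 0 T) ∧ ∃ R, ∀ t ∈ Icc 0 T,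
      ∀ᵐ x ∂(AddCircle.haarAddCircle (T := 2 * π)), ‖u t x‖ ≤ R := by
  obtain ⟨C, hC⟩ := exists_wienerNorm_le hs
  have hw : ∀ t ∈ Icc 0 T, Tendsto (fun τ => wienerNorm (u τ - u t)) (𝓝[Icc 0 T] t) (𝓝 0) := by
    intro t ht
    have h := (hcont t ht).const_mul C
    rw [mul_zero] at h
    refine squeeze_zero' (Eventually.of_forall fun τ => tsum_nonneg fun _ => norm_nonneg _) ?_ h
    filter_upwards [self_mem_nhdsWithin] with τ hτ
    exact (hC _ ((hmem τ hτ).sub (hmem t ht))).2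
  refine ⟨fun t ht => ?_, ?_⟩
  · rw [ContinuousWithinAt, tendsto_iff_norm_sub_tendsto_zero]
    refine squeeze_zero' (Eventually.of_forall fun τ => norm_nonneg _) ?_ (hw t ht)
    filter_upwards [self_mem_nhdsWithin] with τ hτ
    exact norm_le_wienerNorm (hC _ ((hmem τ hτ).sub (hmem t ht))).1
  -- Continuity on a compact interval turns the bounds at each time into one bound `R` for all
  -- times.
  · have hwc : ContinuousOn (fun t => wienerNorm (u t)) (Icc 0 T) := fun t ht => by
      rw [ContinuousWithinAt, tendsto_iff_norm_sub_tendsto_zero]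
      refine squeeze_zero' (Eventually.of_forall fun τ => norm_nonneg _) ?_ (hw t ht)
      filter_upwards [self_mem_nhdsWithin] with τ hτ
      exact abs_wienerNorm_sub_le (hC _ (hmem τ hτ)).1 (hC _ (hmem t ht)).1
        (hC _ ((hmem τ hτ).sub (hmem t ht))).1
    obtain ⟨R, hR⟩ := isCompact_Icc.exists_bound_of_continuousOn hwc
    refine ⟨R, fun t ht => ?_⟩
    filter_upwards [ae_norm_le_wienerNorm (hC _ (hmem t ht)).1] with x hx
    exact hx.trans ((le_abs_self _).trans (hR t ht))

/-! ### The cubic nonlinearity -/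

lemma memLp_cubic {f : L2} {R : ℝ}
    (hf : ∀ᵐ x ∂(AddCircle.haarAddCircle (T := 2 * π)), ‖f x‖ ≤ R) :
    MemLp (fun x : Torus => ((‖f x‖ ^ 2 : ℝ) : ℂ) * f x) 2 AddCircle.haarAddCircle := by
  have hm := (Lp.aestronglyMeasurable f)
  refine (Lp.memLp f).of_le_mul (c := R ^ 2)
    ((Complex.continuous_ofReal.comp_aestronglyMeasurable (hm.norm.pow 2)).mul hm) ?_
  filter_upwards [hf] with x hx
  rw [norm_mul, Complex.norm_real, Real.norm_of_nonneg (sq_nonneg _)]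
  gcongr

lemma coeFn_cubic {f : L2} {R : ℝ}
    (hf : ∀ᵐ x ∂(AddCircle.haarAddCircle (T := 2 * π)), ‖f x‖ ≤ R) :
    cubic f =ᵐ[AddCircle.haarAddCircle] fun x : Torus => ((‖f x‖ ^ 2 : ℝ) : ℂ) * f x := by
  rw [cubic, dif_pos (memLp_cubic hf)]
  exact MemLp.coeFn_toLp _

/-- The Lipschitz constant depends on sup bounds only, so uniqueness can be closed in `L²`. -/
lemma norm_cubic_sub_cubic_le {f g : L2} {R : ℝ}
    (hf : ∀ᵐ x ∂(AddCircle.haarAddCircle (T := 2 * π)), ‖f x‖ ≤ R)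
    (hg : ∀ᵐ x ∂(AddCircle.haarAddCircle (T := 2 * π)), ‖g x‖ ≤ R) :
    ‖cubic f - cubic g‖ ≤ 3 * R ^ 2 * ‖f - g‖ := by
  refine Lp.norm_le_mul_norm_of_ae_le_mul ?_
  filter_upwards [hf, hg, coeFn_cubic hf, coeFn_cubic hg, Lp.coeFn_sub (cubic f) (cubic g),
    Lp.coeFn_sub f g] with x h1 h2 h3 h4 h5 h6
  rw [h5, h6, Pi.sub_apply, Pi.sub_apply, h3, h4]
  exact norm_cubic_sub_le h1 h2

lemma continuousOn_cubic_comp {u : ℝ → L2} {s : Set ℝ} {R : ℝ} (hu : ContinuousOn u s)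
    (hR : ∀ t ∈ s, ∀ᵐ x ∂(AddCircle.haarAddCircle (T := 2 * π)), ‖u t x‖ ≤ R) :
    ContinuousOn (fun t => cubic (u t)) s := by
  intro t ht
  rw [ContinuousWithinAt, tendsto_iff_norm_sub_tendsto_zero]
  have h := (tendsto_iff_norm_sub_tendsto_zero.1 (hu t ht)).const_mul (3 * R ^ 2)
  rw [mul_zero] at h
  refine squeeze_zero' (Eventually.of_forall fun τ => norm_nonneg _) ?_ h
  filter_upwards [self_mem_nhdsWithin] with τ hτ
  exact norm_cubic_sub_cubic_le (hR τ hτ) (hR t ht)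

/-- Unconditional uniqueness in `C([0,T]; H^{α/2})`. -/
lemma IsSolution.eqOn {α μ T : ℝ} (hα : 1 < α) {u₀ : L2} {u v : ℝ → L2}
    (hu : IsSolution α μ T u₀ u) (hv : IsSolution α μ T u₀ v) : EqOn u v (Icc 0 T) := by
  -- For `α > 1` the space `H^{α/2}` embeds into bounded functions.
  have hs : 1 / 2 < α / 2 := by linarith
  obtain ⟨huc, R₁, hR₁⟩ := continuousOn_and_bounded_of_sobolev hs hu.mem_sobolev
    hu.continuous_sobolev
  obtain ⟨hvc, R₂, hR₂⟩ := continuousOn_and_bounded_of_sobolev hs hv.mem_sobolev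
    hv.continuous_sobolev
  refine duhamel_unique (U := propagator α) (N := cubic) (C := 1) (L := 3 * max R₁ R₂ ^ 2)
    (fun t f g => ?_) (fun t _ g hg => continuousOn_propagator_comp hg) zero_le_one huc hvc
    (continuousOn_cubic_comp huc hR₁) (continuousOn_cubic_comp hvc hR₂) (fun t ht => ?_)
    hu.duhamel hv.duhamel
  · rw [← propagator_sub, norm_propagator, one_mul]
  · exact norm_cubic_sub_cubic_le ((hR₁ t ht).mono fun x hx => hx.trans (le_max_left _ _))
      ((hR₂ t ht).mono fun x hx => hx.trans (le_max_right _ _))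

/-! ### Plane waves on the torus -/

lemma repr_smul_fourierLp (c : ℂ) (q k : ℤ) :
    fourierBasis.repr (c • (fourierLp 2 q : L2)) k = if k = q then c else 0 := by
  rw [← coe_fourierBasis, map_smul, HilbertBasis.repr_self, lp.coeFn_smul, Pi.smul_apply,
    lp.single_apply, Pi.single_apply]
  split_ifs <;> simp

lemma fourierHat_smul_fourierLp (c : ℂ) (q k : ℤ) :
    fourierHat (c • (fourierLp 2 q : L2)) k = if k = q then 2 * π * c else 0 := by
  rw [fourierHat_eq_repr, repr_smul_fourierLp]; split_ifs <;> simp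

lemma hasSum_sobolev_smul_fourierLp (s : ℝ) (c : ℂ) (q : ℤ) :
    HasSum (fun k : ℤ => (1 + (k : ℝ) ^ 2) ^ s * ‖fourierHat (c • (fourierLp 2 q : L2)) k‖ ^ 2)
      ((1 + (q : ℝ) ^ 2) ^ s * (2 * π * ‖c‖) ^ 2) := by
  have h := hasSum_single (f := fun k : ℤ => (1 + (k : ℝ) ^ 2) ^ s *
    ‖fourierHat (c • (fourierLp 2 q : L2)) k‖ ^ 2) q (fun k hk => by
      simp only [fourierHat_smul_fourierLp, if_neg hk]; simp)
  simpa only [fourierHat_smul_fourierLp, if_true, norm_mul, Complex.norm_real,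
    Real.norm_of_nonneg Real.pi_nonneg, Complex.norm_ofNat] using h

lemma memSobolev_smul_fourierLp (s : ℝ) (c : ℂ) (q : ℤ) :
    MemSobolev s (c • (fourierLp 2 q : L2)) :=
  (hasSum_sobolev_smul_fourierLp s c q).summable

lemma sobolevNorm_smul_fourierLp (s : ℝ) (c : ℂ) (q : ℤ) :
    sobolevNorm s (c • (fourierLp 2 q : L2)) =
      √(2 * π * (1 + (q : ℝ) ^ 2) ^ s) * ‖c‖ := by
  rw [sobolevNorm, (hasSum_sobolev_smul_fourierLp s c q).tsum_eq]
  rw [show (2 * π)⁻¹ * ((1 + (q : ℝ) ^ 2) ^ s * (2 * π * ‖c‖) ^ 2) =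
    2 * π * (1 + (q : ℝ) ^ 2) ^ s * ‖c‖ ^ 2 by field_simp]
  rw [Real.sqrt_mul (by positivity), Real.sqrt_sq (norm_nonneg _)]

lemma propagator_smul_fourierLp (α t : ℝ) (c : ℂ) (q : ℤ) :
    propagator α t (c • (fourierLp 2 q : L2)) =
      (c * Complex.exp (Complex.I * ((-(t * |(q : ℝ)| ^ α) : ℝ) : ℂ))) • (fourierLp 2 q : L2) := by
  refine L2_ext_repr fun k => ?_
  rw [repr_propagator, repr_smul_fourierLp, repr_smul_fourierLp]
  split_ifs with h
  · rw [h, mul_comm]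
  · simp

lemma coeFn_smul_fourierLp (c : ℂ) (q : ℤ) :
    (c • (fourierLp 2 q : L2) : L2) =ᵐ[AddCircle.haarAddCircle] fun x => c * fourier q x := by
  filter_upwards [Lp.coeFn_smul c (fourierLp 2 q : L2), coeFn_fourierLp (T := 2 * π) 2 q]
    with x h1 h2
  rw [h1, Pi.smul_apply, h2, smul_eq_mul]

lemma norm_fourier_apply (q : ℤ) (x : Torus) : ‖fourier q x‖ = 1 := Circle.norm_coe _

lemma cubic_smul_fourierLp (c : ℂ) (q : ℤ) :
    cubic (c • (fourierLp 2 q : L2)) = (((‖c‖ ^ 2 : ℝ) : ℂ) * c) • (fourierLp 2 q : L2) := by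
  have hb : ∀ᵐ x ∂(AddCircle.haarAddCircle (T := 2 * π)),
      ‖(c • (fourierLp 2 q : L2) : L2) x‖ ≤ ‖c‖ := by
    filter_upwards [coeFn_smul_fourierLp c q] with x hx
    rw [hx, norm_mul, norm_fourier_apply, mul_one]
  refine Lp.ext ?_
  filter_upwards [coeFn_cubic hb, coeFn_smul_fourierLp c q,
    coeFn_smul_fourierLp (((‖c‖ ^ 2 : ℝ) : ℂ) * c) q] with x h1 h2 h3
  rw [h1, h2, h3, norm_mul, norm_fourier_apply, mul_one, mul_assoc]

/-- The plane wave with amplitude `a` and frequency `q` solves the equation on the torus. -/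
lemma isSolution_planeWave (α μ T : ℝ) (a : ℂ) (q : ℤ) :
    IsSolution α μ T (a • (fourierLp 2 q : L2)) (fun t =>
      (a * Complex.exp (Complex.I * ((-(t * (|(q : ℝ)| ^ α + μ * ‖a‖ ^ 2)) : ℝ) : ℂ))) •
        (fourierLp 2 q : L2)) where
  mem_sobolev t _ := memSobolev_smul_fourierLp _ _ _
  continuous_sobolev t _ := by
    simp only [← sub_smul, sobolevNorm_smul_fourierLp]
    have hc : Continuous fun τ : ℝ => √(2 * π * (1 + (q : ℝ) ^ 2) ^ (α / 2)) *
        ‖a * Complex.exp (Complex.I * ((-(τ * (|(q : ℝ)| ^ α + μ * ‖a‖ ^ 2)) : ℝ) : ℂ)) -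
          a * Complex.exp (Complex.I * ((-(t * (|(q : ℝ)| ^ α + μ * ‖a‖ ^ 2)) : ℝ) : ℂ))‖ := by
      fun_prop
    have := (hc.tendsto t).mono_left (nhdsWithin_le_nhds (s := Icc 0 T))
    simpa using this
  duhamel t _ := by
    simp only [cubic_smul_fourierLp, propagator_smul_fourierLp, norm_mul,
      Complex.norm_exp_I_mul_ofReal, mul_one]
    rw [planeWave_duhamel]
    simp only [mul_assoc]
    rfl

/-! ### Characters and the propagator on the lattice -/

lemma mesh_pos (M : ℕ) [NeZero M] : 0 < mesh M :=
  div_pos Real.pi_pos (Nat.cast_pos.2 (NeZero.pos M))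

lemma mesh_mul_cast (M : ℕ) [NeZero M] : mesh M * M = π :=
  div_mul_cancel₀ _ (Nat.cast_ne_zero.2 (NeZero.ne M))

/-- Since `mesh M * 2M = 2π`, the choice of representative is immaterial. This form gives access to
orthogonality of additive characters. -/
lemma latticeChar_eq_stdAddChar (M : ℕ) [NeZero M] (k : ℤ) (j : ZMod (2 * M)) :
    latticeChar M k j = ZMod.stdAddChar ((k : ZMod (2 * M)) * j) := by
  have hj : (k : ZMod (2 * M)) * j = ((k * (j.val : ℤ) : ℤ) : ZMod (2 * M)) := by
    push_cast; rw [ZMod.natCast_zmod_val]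
  have hM : (M : ℂ) ≠ 0 := Nat.cast_ne_zero.2 (NeZero.ne M)
  rw [hj, ZMod.stdAddChar_coe, latticeChar, mesh]
  congr 1
  push_cast
  field_simp

/-- Needed for interpolation, whose node indices may be negative and whose right node may wrap
around. -/
lemma latticeChar_intCast (M : ℕ) [NeZero M] (k n : ℤ) :
    latticeChar M k (n : ZMod (2 * M)) = Complex.exp (Complex.I * ((k * (mesh M * n) : ℝ) : ℂ)) := by
  have hM : (M : ℂ) ≠ 0 := Nat.cast_ne_zero.2 (NeZero.ne M)
  rw [latticeChar_eq_stdAddChar, ← Int.cast_mul, ZMod.stdAddChar_coe, mesh]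
  congr 1
  push_cast
  field_simp

lemma norm_latticeChar (M : ℕ) (k : ℤ) (j : ZMod (2 * M)) : ‖latticeChar M k j‖ = 1 :=
  Complex.norm_exp_I_mul_ofReal _

lemma latticeFourier_latticeChar (M : ℕ) [NeZero M] (a : ℂ) {q k : ℤ}
    (hq : q ∈ Finset.Ico (-(M : ℤ)) M) (hk : k ∈ Finset.Ico (-(M : ℤ)) M) :
    latticeFourier M (a • latticeChar M q) k = if k = q then 2 * π * a else 0 := by
  have hsum : ∑ j : ZMod (2 * M), (a • latticeChar M q) j * latticeChar M (-k) j =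
      a * ∑ j : ZMod (2 * M), ZMod.stdAddChar (j * ((q - k : ℤ) : ZMod (2 * M))) := by
    rw [Finset.mul_sum]
    refine Finset.sum_congr rfl fun j _ => ?_
    rw [Pi.smul_apply, smul_eq_mul, latticeChar_eq_stdAddChar, latticeChar_eq_stdAddChar,
      mul_assoc, ← AddChar.map_add_eq_mul]
    congr 2
    push_cast; ring
  rw [Finset.mem_Ico] at hq hk
  have hiff : ((q - k : ℤ) : ZMod (2 * M)) = 0 ↔ k = q := by
    rw [ZMod.intCast_zmod_eq_zero_iff_dvd]
    refine ⟨fun h => ?_, fun h => by simp [h]⟩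
    -- Two frequencies in the window differ by less than `2M`, so there is no aliasing.
    have := Int.eq_zero_of_abs_lt_dvd h (by push_cast; rw [abs_lt]; constructor <;> linarith)
    linarith
  rw [latticeFourier, hsum, AddChar.sum_mulShift _ (ZMod.isPrimitive_stdAddChar _), ZMod.card]
  simp only [hiff]
  split_ifs
  · have h := mesh_mul_cast M
    have h' : (mesh M : ℂ) * M = π := by exact_mod_cast h
    push_cast
    linear_combination (2 * a) * h'
  · simp

lemma latticePropagator_latticeChar (α : ℝ) (M : ℕ) [NeZero M] (t : ℝ) (a : ℂ) {q : ℤ}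
    (hq : q ∈ Finset.Ico (-(M : ℤ)) M) :
    latticePropagator α M t (a • latticeChar M q) =
      (a * Complex.exp (Complex.I * ((-(t * latticeSymbol α M q) : ℝ) : ℂ))) •
        latticeChar M q := by
  funext j
  rw [latticePropagator, Finset.sum_eq_single_of_mem q hq fun k hk hkq => by
      rw [latticeFourier_latticeChar M a hq hk, if_neg hkq, mul_zero, zero_mul],
    latticeFourier_latticeChar M a hq hq, if_pos rfl, Pi.smul_apply, smul_eq_mul]
  have : (π : ℂ) ≠ 0 := Complex.ofReal_ne_zero.2 Real.pi_ne_zero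
  field_simp

lemma latticeFourier_sub (M : ℕ) [NeZero M] (f g : LatticeFun M) (k : ℤ) :
    latticeFourier M (f - g) k = latticeFourier M f k - latticeFourier M g k := by
  simp only [latticeFourier, Pi.sub_apply, sub_mul, Finset.sum_sub_distrib, mul_sub]

lemma latticePropagator_sub (α : ℝ) (M : ℕ) [NeZero M] (t : ℝ) (f g : LatticeFun M) :
    latticePropagator α M t (f - g) = latticePropagator α M t f - latticePropagator α M t g := by
  funext j
  simp only [latticePropagator, latticeFourier_sub, Pi.sub_apply, sub_mul, mul_sub,
    Finset.sum_sub_distrib]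

lemma norm_latticeFourier_le (M : ℕ) [NeZero M] (f : LatticeFun M) (k : ℤ) :
    ‖latticeFourier M f k‖ ≤ 2 * π * ‖f‖ := by
  rw [latticeFourier, norm_mul, Complex.norm_real, Real.norm_of_nonneg (mesh_pos M).le]
  have h : ‖∑ j : ZMod (2 * M), f j * latticeChar M (-k) j‖ ≤ 2 * M * ‖f‖ := by
    refine (norm_sum_le_of_le _ fun j _ => ?_).trans_eq
      (b := ∑ _j : ZMod (2 * M), ‖f‖) (by simp [ZMod.card])
    rw [norm_mul, norm_latticeChar, mul_one]
    exact norm_le_pi_norm f j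
  calc mesh M * _ ≤ mesh M * (2 * M * ‖f‖) := mul_le_mul_of_nonneg_left h (mesh_pos M).le
    _ = 2 * (mesh M * M) * ‖f‖ := by ring
    _ = _ := by rw [mesh_mul_cast]

/-- Crude triangle inequality over the `2M` frequencies. Growth in `M` is harmless, since uniqueness
is proved for each fixed `M`. -/
lemma norm_latticePropagator_le (α : ℝ) (M : ℕ) [NeZero M] (t : ℝ) (f : LatticeFun M) :
    ‖latticePropagator α M t f‖ ≤ 2 * M * ‖f‖ := by
  refine (pi_norm_le_iff_of_nonneg (by positivity)).2 fun j => ?_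
  have h : ‖∑ k ∈ Finset.Ico (-(M : ℤ)) M,
      Complex.exp (Complex.I * ((-(t * latticeSymbol α M k) : ℝ) : ℂ))
        * latticeFourier M f k * latticeChar M k j‖ ≤ 2 * M * (2 * π * ‖f‖) := by
    refine (norm_sum_le_of_le _ fun k _ => ?_).trans_eq
      (b := ∑ _k ∈ Finset.Ico (-(M : ℤ)) M, 2 * π * ‖f‖) ?_
    · rw [norm_mul, norm_mul, norm_latticeChar, Complex.norm_exp_I_mul_ofReal, one_mul, mul_one]
      exact norm_latticeFourier_le M f k
    · rw [Finset.sum_const, Int.card_Ico, nsmul_eq_mul]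
      congr 1
      rw [show (M : ℤ) - -(M : ℤ) = ((2 * M : ℕ) : ℤ) by push_cast; ring, Int.toNat_natCast]
      push_cast; ring
  rw [latticePropagator, norm_mul, norm_inv, norm_mul, Complex.norm_real,
    Real.norm_of_nonneg Real.pi_nonneg, Complex.norm_ofNat]
  rw [inv_mul_le_iff₀ (by positivity)]
  linarith

lemma continuousOn_latticePropagator_comp {α t : ℝ} {M : ℕ} [NeZero M] {g : ℝ → LatticeFun M}
    {s : Set ℝ} (hg : ContinuousOn g s) :
    ContinuousOn (fun τ => latticePropagator α M (t - τ) (g τ)) s := by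
  have hgj : ∀ j, ContinuousOn (fun τ => g τ j) s := continuousOn_pi.1 hg
  refine continuousOn_pi.2 fun j => ?_
  simp only [latticePropagator, latticeFourier]
  fun_prop

lemma IsLatticeSolution.eqOn {α μ T : ℝ} {M : ℕ} [NeZero M] {w₀ : LatticeFun M}
    {v w : ℝ → LatticeFun M} (hv : IsLatticeSolution α μ T M w₀ v)
    (hw : IsLatticeSolution α μ T M w₀ w) : EqOn v w (Icc 0 T) := by
  obtain ⟨R₁, hR₁⟩ := isCompact_Icc.exists_bound_of_continuousOn hv.continuousOn
  obtain ⟨R₂, hR₂⟩ := isCompact_Icc.exists_bound_of_continuousOn hw.continuousOn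
  have hN : ∀ {g : ℝ → LatticeFun M}, ContinuousOn g (Icc 0 T) →
      ContinuousOn (fun τ j => ((‖g τ j‖ ^ 2 : ℝ) : ℂ) * g τ j) (Icc 0 T) := fun {g} hg => by
    have hgj : ∀ j, ContinuousOn (fun τ => g τ j) (Icc 0 T) := continuousOn_pi.1 hg
    refine continuousOn_pi.2 fun j => ?_
    exact (Complex.continuous_ofReal.comp_continuousOn ((hgj j).norm.pow 2)).mul (hgj j)
  refine duhamel_unique (U := latticePropagator α M)
    (N := fun g j => ((‖g j‖ ^ 2 : ℝ) : ℂ) * g j) (C := 2 * M) (L := 3 * max R₁ R₂ ^ 2)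
    (fun t f g => ?_) (fun t _ g hg => continuousOn_latticePropagator_comp hg) (by positivity)
    hv.continuousOn hw.continuousOn (hN hv.continuousOn) (hN hw.continuousOn) (fun t ht => ?_)
    hv.duhamel hw.duhamel
  · rw [← latticePropagator_sub]; exact norm_latticePropagator_le _ _ _ _
  · refine (pi_norm_le_iff_of_nonneg (by positivity)).2 fun j => ?_
    refine (norm_cubic_sub_le (R := max R₁ R₂)
      ((norm_le_pi_norm (v t) j).trans ((hR₁ t ht).trans (le_max_left _ _)))
      ((norm_le_pi_norm (w t) j).trans ((hR₂ t ht).trans (le_max_right _ _)))).trans ?_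
    exact mul_le_mul_of_nonneg_left (norm_le_pi_norm (v t - w t) j) (by positivity)

/-- The plane wave with amplitude `a` and frequency `q` solves the lattice equation. -/
lemma isLatticeSolution_planeWave (α μ T : ℝ) (M : ℕ) [NeZero M] (a : ℂ) {q : ℤ}
    (hq : q ∈ Finset.Ico (-(M : ℤ)) M) :
    IsLatticeSolution α μ T M (a • latticeChar M q) (fun t =>
      (a * Complex.exp (Complex.I * ((-(t * (latticeSymbol α M q + μ * ‖a‖ ^ 2)) : ℝ) : ℂ))) •
        latticeChar M q) where
  continuousOn := by
    refine Continuous.continuousOn ?_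
    have hc : Continuous fun t : ℝ => a * Complex.exp
        (Complex.I * ((-(t * (latticeSymbol α M q + μ * ‖a‖ ^ 2)) : ℝ) : ℂ)) := by fun_prop
    exact hc.smul continuous_const
  duhamel t _ := by
    have hN : ∀ c : ℂ, (fun j => ((‖(c • latticeChar M q) j‖ ^ 2 : ℝ) : ℂ) *
        (c • latticeChar M q) j) = (((‖c‖ ^ 2 : ℝ) : ℂ) * c) • latticeChar M q := fun c => by
      funext j
      simp only [Pi.smul_apply, smul_eq_mul, norm_mul, norm_latticeChar, mul_one, mul_assoc]
    simp only [hN, latticePropagator_latticeChar α M _ _ hq, norm_mul,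
      Complex.norm_exp_I_mul_ofReal, mul_one]
    rw [planeWave_duhamel]
    simp only [mul_assoc]

/-! ### Discretization and interpolation of plane waves -/

lemma fourier_coe_eq_exp (q : ℤ) (y : ℝ) :
    fourier q (y : Torus) = Complex.exp (Complex.I * ((q * y : ℝ) : ℂ)) := by
  rw [fourier_coe_apply]
  congr 1
  have : (π : ℂ) ≠ 0 := Complex.ofReal_ne_zero.2 Real.pi_ne_zero
  push_cast
  field_simp

lemma norm_exp_I_mul_sub_exp_le (x y : ℝ) :
    ‖Complex.exp (Complex.I * x) - Complex.exp (Complex.I * y)‖ ≤ |x - y| := by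
  have h : Complex.exp (Complex.I * x) - Complex.exp (Complex.I * y) =
      Complex.exp (Complex.I * y) * (Complex.exp (Complex.I * ((x - y : ℝ) : ℂ)) - 1) := by
    rw [mul_sub, ← Complex.exp_add, mul_one]; congr 2; push_cast; ring
  rw [h, norm_mul, Complex.norm_exp_I_mul_ofReal, one_mul]
  exact Real.norm_exp_I_mul_ofReal_sub_one_le

/-- The factor by which averaging over a cell multiplies a plane wave. -/
noncomputable def cellAverage (M : ℕ) (q : ℤ) : ℂ :=
  (mesh M : ℂ)⁻¹ * ∫ y in (0 : ℝ)..mesh M, Complex.exp (Complex.I * ((q * y : ℝ) : ℂ))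

lemma norm_cellAverage_le (M : ℕ) [NeZero M] (q : ℤ) : ‖cellAverage M q‖ ≤ 1 := by
  have hh := mesh_pos M
  rw [cellAverage, norm_mul, norm_inv, Complex.norm_real, Real.norm_of_nonneg hh.le,
    inv_mul_le_iff₀ hh]
  have := intervalIntegral.norm_integral_le_of_norm_le_const (a := 0) (b := mesh M) (C := 1)
    (f := fun y : ℝ => Complex.exp (Complex.I * ((q * y : ℝ) : ℂ)))
    fun y _ => (Complex.norm_exp_I_mul_ofReal _).le
  simpa [abs_of_pos hh] using this

lemma norm_cellAverage_sub_one_le (M : ℕ) [NeZero M] (q : ℤ) :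
    ‖cellAverage M q - 1‖ ≤ |(q : ℝ)| * mesh M := by
  have hh := mesh_pos M
  have hh' : (mesh M : ℂ) ≠ 0 := Complex.ofReal_ne_zero.2 hh.ne'
  have h1 : cellAverage M q - 1 = (mesh M : ℂ)⁻¹ *
      ∫ y in (0 : ℝ)..mesh M, (Complex.exp (Complex.I * ((q * y : ℝ) : ℂ)) - 1) := by
    rw [intervalIntegral.integral_sub (Continuous.intervalIntegrable (by fun_prop) _ _)
      (by simp), mul_sub, cellAverage]
    simp [hh']
  rw [h1, norm_mul, norm_inv, Complex.norm_real, Real.norm_of_nonneg hh.le, inv_mul_le_iff₀ hh]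
  have := intervalIntegral.norm_integral_le_of_norm_le_const (a := 0) (b := mesh M)
    (C := |(q : ℝ)| * mesh M)
    (f := fun y : ℝ => Complex.exp (Complex.I * ((q * y : ℝ) : ℂ)) - 1) fun y hy => by
      rw [uIoc_of_le hh.le] at hy
      refine Real.norm_exp_I_mul_ofReal_sub_one_le.trans ?_
      rw [norm_mul, Real.norm_eq_abs, Real.norm_of_nonneg hy.1.le]
      exact mul_le_mul_of_nonneg_left hy.2 (abs_nonneg _)
  rw [sub_zero, abs_of_pos hh] at this
  linarith

/-- The quotient map preserves measure on one period, so null sets lift to intervals no longer than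
that. -/
lemma intervalIntegral_congr_haar {f g : Torus → ℂ}
    (hfg : f =ᵐ[AddCircle.haarAddCircle] g) {a b : ℝ} (hab : a ≤ b) (hb : b ≤ a + 2 * π) :
    ∫ y in a..b, f (y : Torus) = ∫ y in a..b, g (y : Torus) := by
  have hvol : f =ᵐ[volume] g := by
    rw [AddCircle.volume_eq_smul_haarAddCircle]
    exact Measure.ae_smul_measure hfg _
  have hpre := (AddCircle.measurePreserving_mk (2 * π) a).quasiMeasurePreserving.ae_eq_comp hvol
  rw [intervalIntegral.integral_of_le hab, intervalIntegral.integral_of_le hab]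
  exact integral_congr_ae (ae_restrict_of_ae_restrict_of_subset (Ioc_subset_Ioc_right hb) hpre)

/-- Translating a cell to the origin splits off the character, so every cell yields the same
averaging factor. -/
lemma discretize_smul_fourierLp (M : ℕ) [NeZero M] (a : ℂ) (q : ℤ) :
    discretize M (a • (fourierLp 2 q : L2)) = (a * cellAverage M q) • latticeChar M q := by
  have hh := mesh_pos M
  have hM : (1 : ℝ) ≤ M := Nat.one_le_cast.2 (NeZero.pos M)
  have hle : mesh M ≤ 2 * π := by
    rw [mesh, div_le_iff₀ (by positivity)]; nlinarith [Real.pi_pos]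
  funext j
  rw [discretize, intervalIntegral_congr_haar (coeFn_smul_fourierLp a q) (by linarith)
    (by linarith)]
  simp only [fourier_coe_eq_exp]
  have hshift := intervalIntegral.integral_comp_add_left (a := 0) (b := mesh M)
    (fun y : ℝ => a * Complex.exp (Complex.I * ((q * y : ℝ) : ℂ))) (mesh M * j.val)
  rw [add_zero] at hshift
  rw [← hshift, Pi.smul_apply, smul_eq_mul, cellAverage, latticeChar]
  have hsplit : ∀ y : ℝ, a * Complex.exp (Complex.I * ((q * (mesh M * j.val + y) : ℝ) : ℂ)) =
      a * Complex.exp (Complex.I * ((q * (mesh M * j.val) : ℝ) : ℂ)) *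
        Complex.exp (Complex.I * ((q * y : ℝ) : ℂ)) := fun y => by
    rw [mul_assoc, ← Complex.exp_add]; congr 2; push_cast; ring
  simp_rw [hsplit]
  rw [intervalIntegral.integral_const_mul]
  ring

lemma interpolate_smul (M : ℕ) (a : ℂ) (g : LatticeFun M) (x : Torus) :
    interpolate M (a • g) x = a * interpolate M g x := by
  simp only [interpolate, Pi.smul_apply, smul_eq_mul]; ring

/-- One `|q| h` pays for moving to the left node, the other for the increment between adjacent
nodes. -/
lemma norm_interpolate_latticeChar_sub_le (M : ℕ) [NeZero M] (q : ℤ) (x : Torus) :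
    ‖interpolate M (latticeChar M q) x - fourier q x‖ ≤ 2 * (|(q : ℝ)| * mesh M) := by
  have hh := mesh_pos M
  simp only [interpolate]
  have hyx : (((AddCircle.equivIco (2 * π) (-π) x : Ico (-π) (-π + 2 * π)) : ℝ) : Torus) = x :=
    AddCircle.coe_equivIco
  set y : ℝ := ((AddCircle.equivIco (2 * π) (-π) x : Ico (-π) (-π + 2 * π)) : ℝ)
  set n : ℤ := ⌊y / mesh M⌋ with hn
  have h1 : mesh M * n ≤ y := by
    have := Int.floor_le (y / mesh M)
    rw [le_div_iff₀ hh] at this; linarith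
  have h2 : y - mesh M * n ≤ mesh M := by
    have := Int.lt_floor_add_one (y / mesh M)
    rw [div_lt_iff₀ hh] at this; linarith
  rw [← hyx, fourier_coe_eq_exp, latticeChar_intCast, latticeChar_intCast]
  have h3 := norm_exp_I_mul_sub_exp_le (q * (mesh M * n)) (q * y)
  have h4 := norm_exp_I_mul_sub_exp_le (q * (mesh M * ((n + 1 : ℤ) : ℝ))) (q * (mesh M * n))
  have h3' : |q * (mesh M * n) - q * y| ≤ |(q : ℝ)| * mesh M := by
    rw [← mul_sub, abs_mul, abs_sub_comm, abs_of_nonneg (by linarith : 0 ≤ y - mesh M * n)]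
    exact mul_le_mul_of_nonneg_left h2 (abs_nonneg _)
  have h4' : |q * (mesh M * ((n + 1 : ℤ) : ℝ)) - q * (mesh M * n)| = |(q : ℝ)| * mesh M := by
    rw [← mul_sub, abs_mul, ← mul_sub]; push_cast; rw [add_sub_cancel_left, mul_one, abs_of_pos hh]
  have h5 : ‖(Complex.exp (Complex.I * ((q * (mesh M * ((n + 1 : ℤ) : ℝ)) : ℝ) : ℂ)) -
      Complex.exp (Complex.I * ((q * (mesh M * n) : ℝ) : ℂ))) / mesh M *
        ((y - mesh M * n : ℝ) : ℂ)‖ ≤ |(q : ℝ)| * mesh M := by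
    rw [norm_mul, norm_div, Complex.norm_real, Complex.norm_real, Real.norm_of_nonneg hh.le,
      Real.norm_of_nonneg (by linarith : 0 ≤ y - mesh M * n), div_mul_eq_mul_div,
      div_le_iff₀ hh]
    exact mul_le_mul (h4.trans h4'.le) h2 (by linarith) (by positivity)
  rw [add_sub_right_comm]
  refine (norm_add_le _ _).trans ?_
  linarith

/-- Interpolated plane waves are as far from plane waves on the torus as the amplitudes are, up
to a small relative error. -/
lemma le_norm_interpolate_sub (M : ℕ) [NeZero M] (q : ℤ) (a b : ℂ) (x : Torus) :
    ‖a - b‖ - ‖a‖ * (2 * (|(q : ℝ)| * mesh M)) ≤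
      ‖interpolate M (a • latticeChar M q) x - b * fourier q x‖ := by
  rw [interpolate_smul]
  have h := norm_sub_le (a * interpolate M (latticeChar M q) x - b * fourier q x)
    (a * (interpolate M (latticeChar M q) x - fourier q x))
  have heq : a * interpolate M (latticeChar M q) x - b * fourier q x -
      a * (interpolate M (latticeChar M q) x - fourier q x) = (a - b) * fourier q x := by ring
  rw [heq, norm_mul, norm_fourier_apply, mul_one, norm_mul] at h
  have h2 := mul_le_mul_of_nonneg_left (norm_interpolate_latticeChar_sub_le M q x) (norm_nonneg a)
  linarith

/-! ### Phase separation -/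

/-- With `s = sin ξ / ξ`, Taylor expansion gives `1 - ξ²/4 ≤ s ≤ 1 - ξ²/10`, and `s² ≤ s^α ≤ s`
removes the exponent. -/
lemma one_sub_sinc_rpow_bounds {ξ α : ℝ} (h0 : 0 < ξ) (h1 : ξ ≤ 1) (hα : α ∈ Icc (1 : ℝ) 2) :
    ξ ^ 2 / 10 ≤ 1 - (Real.sin ξ / ξ) ^ α ∧ 1 - (Real.sin ξ / ξ) ^ α ≤ ξ ^ 2 / 2 := by
  have hb := abs_le.1 (Real.sin_bound (x := ξ) (by rwa [abs_of_pos h0]))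
  rw [abs_of_pos h0] at hb
  have h5 : ξ ^ 5 ≤ ξ ^ 3 := pow_le_pow_of_le_one h0.le h1 (by norm_num)
  have hlo : 1 - ξ ^ 2 / 4 ≤ Real.sin ξ / ξ := by
    rw [le_div_iff₀ h0]; nlinarith [pow_pos h0 3]
  have hhi : Real.sin ξ / ξ ≤ 1 - ξ ^ 2 / 10 := by
    rw [div_le_iff₀ h0]; nlinarith [pow_pos h0 3]
  have hs0 : 0 < Real.sin ξ / ξ := by nlinarith
  have hs1 : Real.sin ξ / ξ ≤ 1 := by nlinarith
  have hle1 : (Real.sin ξ / ξ) ^ α ≤ Real.sin ξ / ξ := by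
    simpa using Real.rpow_le_rpow_of_exponent_ge hs0 hs1 hα.1
  have hle2 : (Real.sin ξ / ξ) ^ 2 ≤ (Real.sin ξ / ξ) ^ α := by
    simpa using Real.rpow_le_rpow_of_exponent_ge hs0 hs1 hα.2
  constructor <;> nlinarith

/-- With `ξ = hq/2` the lattice symbol is `q^α (sin ξ / ξ)^α`, so the relative gap is of order `ξ²`,
from above and below. -/
lemma symbol_sub_latticeSymbol_bounds {α : ℝ} (hα : α ∈ Icc (1 : ℝ) 2) (M : ℕ) [NeZero M]
    {q : ℤ} (hq : 0 < q) (hqh : (q : ℝ) * mesh M ≤ 1) :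
    (q : ℝ) ^ (2 + α) * mesh M ^ 2 / 40 ≤ |(q : ℝ)| ^ α - latticeSymbol α M q ∧
      |(q : ℝ)| ^ α - latticeSymbol α M q ≤ (q : ℝ) ^ (2 + α) * mesh M ^ 2 / 8 := by
  have hh := mesh_pos M
  have hq' : (0 : ℝ) < q := Int.cast_pos.2 hq
  set ξ : ℝ := mesh M * q / 2 with hξ
  have hξ0 : 0 < ξ := by positivity
  have hξ1 : ξ ≤ 1 := by rw [hξ]; nlinarith
  have hb := one_sub_sinc_rpow_bounds hξ0 hξ1 hα
  have hsin : 0 < Real.sin ξ :=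
    Real.sin_pos_of_pos_of_lt_pi hξ0 (by linarith [Real.pi_gt_three])
  have hsym : latticeSymbol α M q = (q : ℝ) ^ α * (Real.sin ξ / ξ) ^ α := by
    rw [latticeSymbol, ← Real.mul_rpow hq'.le (by positivity), ← hξ, abs_of_pos (by positivity)]
    congr 1
    rw [hξ]; field_simp
  have hpow : (q : ℝ) ^ (2 + α) = (q : ℝ) ^ α * (q : ℝ) ^ 2 := by
    rw [add_comm, Real.rpow_add hq', Real.rpow_two]
  have hqα : 0 < (q : ℝ) ^ α := by positivity
  rw [hsym, abs_of_pos hq', hpow, ← mul_one_sub]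
  have e1 : (q : ℝ) ^ α * (q : ℝ) ^ 2 * mesh M ^ 2 / 40 = (q : ℝ) ^ α * (ξ ^ 2 / 10) := by
    rw [hξ]; ring
  have e2 : (q : ℝ) ^ α * (q : ℝ) ^ 2 * mesh M ^ 2 / 8 = (q : ℝ) ^ α * (ξ ^ 2 / 2) := by
    rw [hξ]; ring
  rw [e1, e2]
  exact ⟨mul_le_mul_of_nonneg_left hb.1 hqα.le, mul_le_mul_of_nonneg_left hb.2 hqα.le⟩

/-- The chord is `2 |sin(θ/2)|`; Jordan's inequality and `π ≤ 4` finish. -/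
lemma half_le_norm_exp_I_mul_sub_one {θ : ℝ} (h0 : 0 ≤ θ) (h1 : θ ≤ 1) :
    θ / 2 ≤ ‖Complex.exp (Complex.I * θ) - 1‖ := by
  rw [Complex.norm_exp_I_mul_ofReal_sub_one, norm_mul, Real.norm_two]
  have h := Real.mul_le_sin (x := θ / 2) (by linarith) (by linarith [Real.pi_gt_three])
  have hpi : (1 : ℝ) / 2 ≤ 2 / π := by
    rw [div_le_div_iff₀ two_pos Real.pi_pos]; linarith [Real.pi_le_four]
  have : 1 / 2 * (θ / 2) ≤ Real.sin (θ / 2) :=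
    (mul_le_mul_of_nonneg_right hpi (by linarith)).trans h
  linarith [le_abs_self (Real.sin (θ / 2)), Real.norm_eq_abs (Real.sin (θ / 2))]

/-- Controls the rounding of `κ`: `κ/2 ≤ x ≤ 3κ/2`, and the constants are the fourth powers of `1/2`
and `3/2`. -/
lemma rpow_bounds_of_abs_sub_le_half {κ p x : ℝ} (hκ : 1 ≤ κ) (hp : p ∈ Icc (0 : ℝ) 4)
    (hx : |κ - x| ≤ 1 / 2) :
    κ ^ p / 16 ≤ x ^ p ∧ x ^ p ≤ 81 / 16 * κ ^ p := by
  have h := abs_le.1 hx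
  have hlo : 1 / 2 * κ ≤ x := by linarith
  have hhi : x ≤ 3 / 2 * κ := by linarith
  have hκp : 0 < κ ^ p := by positivity
  constructor
  · have h1 := Real.rpow_le_rpow (by positivity) hlo hp.1
    rw [Real.mul_rpow (by norm_num) (by positivity)] at h1
    have h2 : (1 / 2 : ℝ) ^ (4 : ℝ) ≤ (1 / 2) ^ p :=
      Real.rpow_le_rpow_of_exponent_ge (by norm_num) (by norm_num) hp.2
    norm_num at h2
    norm_num at h1
    nlinarith
  · have h1 := Real.rpow_le_rpow (by linarith) hhi hp.1
    rw [Real.mul_rpow (by norm_num) (by positivity)] at h1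
    have h2 : (3 / 2 : ℝ) ^ p ≤ (3 / 2) ^ (4 : ℝ) :=
      Real.rpow_le_rpow_of_exponent_le (by norm_num) hp.2
    norm_num at h2
    nlinarith

/-- A pointwise lower bound for the error on a nontrivial part of `[0,T]` bounds the error norm
from below. -/
lemma ofReal_le_errorNorm {T B : ℝ} (hT : 0 < T) (hB : 0 ≤ B) (M : ℕ) {w : ℝ → LatticeFun M}
    {u : ℝ → L2} (h : ∀ t ∈ Icc (T / 2) T, ∀ᵐ x ∂(AddCircle.haarAddCircle (T := 2 * π)),
      B ≤ ‖interpolate M (w t) x - u t x‖) :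
    ENNReal.ofReal B ≤ errorNorm T M w u := by
  have hae := ae_le_essSup (μ := volume.restrict (Icc 0 T))
    (f := fun t => eLpNorm (fun x : Torus => interpolate M (w t) x - u t x) 2 volume)
  have hae' := ae_restrict_of_ae_restrict_of_subset
    (Icc_subset_Icc_left (by linarith : 0 ≤ T / 2)) hae
  have hne : (volume.restrict (Icc (T / 2) T)) ≠ 0 := by
    rw [Ne, Measure.restrict_eq_zero, Real.volume_Icc, ENNReal.ofReal_eq_zero]
    linarith
  have : NeBot (ae (volume.restrict (Icc (T / 2) T))) := ae_neBot.2 hne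
  -- As `[T/2, T]` has positive measure, it contains a time at which the essential supremum
  -- dominates the slice norm.
  obtain ⟨t, ht, htmem⟩ := (hae'.and (ae_restrict_mem measurableSet_Icc)).exists
  refine le_trans ?_ ht
  have hvol : ∀ᵐ x : Torus, ‖(fun _ : Torus => B) x‖ ≤
      ‖interpolate M (w t) x - u t x‖ := by
    rw [AddCircle.volume_eq_smul_haarAddCircle]
    refine Measure.ae_smul_measure ?_ _
    filter_upwards [h t htmem] with x hx
    rwa [Real.norm_of_nonneg hB]
  refine le_trans ?_ (eLpNorm_mono_ae hvol)
  -- The torus has mass `2π ≥ 1`, so the constant `B` has `L²` norm at least `B`.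
  rw [eLpNorm_const' _ (by norm_num) (by norm_num), AddCircle.measure_univ,
    Real.enorm_eq_ofReal hB]
  refine le_mul_of_one_le_right' (ENNReal.one_le_rpow ?_ (by norm_num))
  rw [ENNReal.one_le_ofReal]
  linarith [Real.pi_gt_three]

/-! ### Amplitude and phase at the critical frequency -/

/-- For small mesh sizes the critical frequency `κ = (T h²)^{-1/(2+α)}` is at least `1`, and
`h κ` is as small as desired. -/
lemma exists_mesh_threshold {α T ε : ℝ} (hα : 1 < α) (hT : 0 < T) (hε : 0 < ε) :
    ∃ h₀ > (0 : ℝ), ∀ h : ℝ, 0 < h → h < h₀ →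
      1 ≤ (T * h ^ 2) ^ (-(1 / (2 + α))) ∧ h * (T * h ^ 2) ^ (-(1 / (2 + α))) < ε := by
  -- `hκ = T^{-1/(2+α)} h^{α/(2+α)}`, because `1 - 2/(2+α) = α/(2+α)`.
  have hp : 0 < α / (2 + α) := by positivity
  have hlim : Tendsto (fun h : ℝ => T ^ (-(1 / (2 + α))) * h ^ (α / (2 + α))) (𝓝 0) (𝓝 0) := by
    have := ((Real.continuous_rpow_const hp.le).tendsto 0).const_mul (T ^ (-(1 / (2 + α))))
    simpa [Real.zero_rpow hp.ne'] using this
  have hlim2 : Tendsto (fun h : ℝ => T * h ^ 2) (𝓝 0) (𝓝 0) := by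
    have : Continuous fun h : ℝ => T * h ^ 2 := by fun_prop
    simpa using this.tendsto 0
  obtain ⟨h₀, hh₀, H⟩ := Metric.eventually_nhds_iff.1
    ((hlim.eventually_lt_const hε).and (hlim2.eventually_lt_const one_pos))
  refine ⟨h₀, hh₀, fun h h0 hlt => ?_⟩
  obtain ⟨H1, H2⟩ := H (y := h) (by rwa [Real.dist_0_eq_abs, abs_of_pos h0])
  refine ⟨?_, ?_⟩
  · exact Real.one_le_rpow_of_pos_of_le_one_of_nonpos (by positivity) H2.le
      (neg_nonpos.2 (by positivity))
  · refine lt_of_eq_of_lt ?_ H1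
    rw [Real.mul_rpow hT.le (by positivity), ← Real.rpow_natCast, ← Real.rpow_mul h0.le,
      mul_left_comm]
    congr 1
    nth_rewrite 1 [← Real.rpow_one h]
    rw [← Real.rpow_add h0]
    congr 1
    push_cast
    field_simp
    ring

/-- The amplitude `⟨q⟩^{-α/2}` is comparable to `h^{α/(2+α)}` at the critical frequency. -/
lemma amplitude_lower_bound {α T h x : ℝ} (hα : α ∈ Ioc (1 : ℝ) 2) (hT : 0 < T) (hh : 0 < h)
    (hκ : 1 ≤ (T * h ^ 2) ^ (-(1 / (2 + α)))) (hx : |(T * h ^ 2) ^ (-(1 / (2 + α))) - x| ≤ 1 / 2) :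
    T ^ (α / (2 * (2 + α))) / 4 * h ^ (α / (2 + α)) ≤ (1 + x ^ 2) ^ (-(α / 4)) := by
  set κ : ℝ := (T * h ^ 2) ^ (-(1 / (2 + α))) with hκdef
  have hα0 : 0 < α := by linarith [hα.1]
  have hκ0 : 0 < κ := by linarith
  have hb := abs_le.1 hx
  -- A generous constant, chosen so that `16^{-α/4} ≥ 16^{-1/2} = 1/4`.
  have h1 : 1 + x ^ 2 ≤ 16 * κ ^ 2 := by nlinarith
  have h2 : (16 * κ ^ 2) ^ (-(α / 4)) ≤ (1 + x ^ 2) ^ (-(α / 4)) :=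
    Real.rpow_le_rpow_of_nonpos (by positivity) h1 (by linarith)
  refine le_trans ?_ h2
  rw [Real.mul_rpow (by norm_num) (by positivity)]
  have h3 : (1 : ℝ) / 4 ≤ 16 ^ (-(α / 4)) := by
    have : (16 : ℝ) ^ (-(1 / 2) : ℝ) ≤ 16 ^ (-(α / 4)) :=
      Real.rpow_le_rpow_of_exponent_le (by norm_num) (by linarith [hα.2])
    refine le_trans (le_of_eq ?_) this
    rw [Real.rpow_neg (by norm_num), ← Real.sqrt_eq_rpow,
      show (16 : ℝ) = 4 ^ 2 by norm_num, Real.sqrt_sq (by norm_num)]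
    norm_num
  have h4 : (κ ^ 2) ^ (-(α / 4)) = T ^ (α / (2 * (2 + α))) * h ^ (α / (2 + α)) := by
    rw [hκdef, ← Real.rpow_natCast, ← Real.rpow_mul (by positivity), ← Real.rpow_mul (by positivity),
      Real.mul_rpow hT.le (by positivity), ← Real.rpow_natCast h, ← Real.rpow_mul hh.le]
    congr 2 <;> · push_cast; field_simp; ring
  rw [h4]
  have : 0 ≤ T ^ (α / (2 * (2 + α))) * h ^ (α / (2 + α)) := by positivity
  nlinarith

/-- Factoring out `A e^{iy}` leaves `(e^{iθ} - 1) + (γ - 1) e^{iθ}` with `θ = x - y`. -/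
lemma le_norm_amplitude_sub {A : ℝ} (hA : 0 ≤ A) (γ : ℂ) (x y : ℝ) :
    A * (‖Complex.exp (Complex.I * ((x - y : ℝ) : ℂ)) - 1‖ - ‖γ - 1‖) ≤
      ‖A * γ * Complex.exp (Complex.I * x) - A * Complex.exp (Complex.I * y)‖ := by
  have hid : A * γ * Complex.exp (Complex.I * x) - A * Complex.exp (Complex.I * y) =
      A * Complex.exp (Complex.I * y) *
        ((Complex.exp (Complex.I * ((x - y : ℝ) : ℂ)) - 1) +
          (γ - 1) * Complex.exp (Complex.I * ((x - y : ℝ) : ℂ))) := by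
    have : Complex.exp (Complex.I * x) =
        Complex.exp (Complex.I * y) * Complex.exp (Complex.I * ((x - y : ℝ) : ℂ)) := by
      rw [← Complex.exp_add]; congr 1; push_cast; ring
    rw [this]; ring
  rw [hid, norm_mul, norm_mul, Complex.norm_exp_I_mul_ofReal, mul_one, Complex.norm_real,
    Real.norm_of_nonneg hA]
  refine mul_le_mul_of_nonneg_left ?_ hA
  have h := norm_sub_le_norm_add (Complex.exp (Complex.I * ((x - y : ℝ) : ℂ)) - 1)
    ((γ - 1) * Complex.exp (Complex.I * ((x - y : ℝ) : ℂ)))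
  rwa [norm_mul (γ - 1), Complex.norm_exp_I_mul_ofReal, mul_one] at h

/-- Error budget: phase separation gives `A/4000`, averaging loses `A/50000` and interpolation
`2A/50000`; more than `A/8000` is left. -/
lemma le_amplitude_gap {A x y η : ℝ} {γ : ℂ} (hA : 0 ≤ A) (hγ : ‖γ‖ ≤ 1) (hγ1 : ‖γ - 1‖ ≤ η)
    (hη : η ≤ 1 / 50000) (hxy : x - y ∈ Icc (1 / 2000 : ℝ) 1) :
    A / 8000 ≤ ‖A * γ * Complex.exp (Complex.I * x) - A * Complex.exp (Complex.I * y)‖ -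
      ‖A * γ * Complex.exp (Complex.I * x)‖ * (2 * η) := by
  have hsep := half_le_norm_exp_I_mul_sub_one (by linarith [hxy.1]) hxy.2
  have hamp := le_norm_amplitude_sub hA γ x y
  have hη0 : 0 ≤ η := (norm_nonneg _).trans hγ1
  have hmul : A * ‖γ‖ * (2 * η) ≤ A * 1 * (2 * (1 / 50000)) := by gcongr
  have hlow : A * (1 / 4000 - 1 / 50000) ≤
      A * (‖Complex.exp (Complex.I * ((x - y : ℝ) : ℂ)) - 1‖ - ‖γ - 1‖) :=
    mul_le_mul_of_nonneg_left (by linarith [hxy.1]) hA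
  rw [norm_mul (A * γ), Complex.norm_exp_I_mul_ofReal, norm_mul (A : ℂ), Complex.norm_real,
    Real.norm_of_nonneg hA, mul_one]
  linarith

/-- At the critical frequency the phases of the two plane waves separate by a definite amount. -/
lemma phase_bounds {α T μ A t : ℝ} {γ : ℂ} (hα : α ∈ Ioc (1 : ℝ) 2) (hT : T ∈ Ioc (0 : ℝ) 1)
    (hμ : |μ| = 1) (M : ℕ) [NeZero M] {q : ℤ} (hq : 0 < q)
    (hκ : 1 ≤ (T * mesh M ^ 2) ^ (-(1 / (2 + α))))
    (hκq : |(T * mesh M ^ 2) ^ (-(1 / (2 + α))) - q| ≤ 1 / 2)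
    (hη : (q : ℝ) * mesh M ≤ 1 / 50000) (hA : A ∈ Icc (0 : ℝ) 1) (hγ : ‖γ‖ ≤ 1)
    (hγ1 : ‖γ - 1‖ ≤ q * mesh M) (ht : t ∈ Icc (T / 2) T) :
    -(t * (latticeSymbol α M q + μ * ‖(A : ℂ) * γ‖ ^ 2)) -
      -(t * (|(q : ℝ)| ^ α + μ * ‖(A : ℂ)‖ ^ 2)) ∈ Icc (1 / 2000 : ℝ) 1 := by
  have hh := mesh_pos M
  have hα0 : 0 < α := by linarith [hα.1]
  obtain ⟨hT0, hT1⟩ := hT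
  have hsym := symbol_sub_latticeSymbol_bounds ⟨hα.1.le, hα.2⟩ M hq (by linarith)
  have hpow := rpow_bounds_of_abs_sub_le_half hκ
    (p := 2 + α) ⟨by linarith, by linarith [hα.2]⟩ hκq
  -- The relation that defines the critical frequency: it makes `T` times the symbol gap of order
  -- one.
  have hκp : ((T * mesh M ^ 2) ^ (-(1 / (2 + α)))) ^ (2 + α) * (T * mesh M ^ 2) = 1 := by
    rw [← Real.rpow_mul (by positivity), show -(1 / (2 + α)) * (2 + α) = -1 by field_simp,
      Real.rpow_neg_one, inv_mul_cancel₀ (by positivity)]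
  set κp := ((T * mesh M ^ 2) ^ (-(1 / (2 + α)))) ^ (2 + α)
  set D := |(q : ℝ)| ^ α - latticeSymbol α M q with hD
  have hTh : 0 < T * mesh M ^ 2 := by positivity
  have hX1 : 1 / 16 ≤ (q : ℝ) ^ (2 + α) * (T * mesh M ^ 2) := by
    have := mul_le_mul_of_nonneg_right hpow.1 hTh.le
    linarith
  have hX2 : (q : ℝ) ^ (2 + α) * (T * mesh M ^ 2) ≤ 81 / 16 := by
    have := mul_le_mul_of_nonneg_right hpow.2 hTh.le
    linarith
  have hTD1 : 1 / 640 ≤ T * D := by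
    have := mul_le_mul_of_nonneg_left hsym.1 hT0.le
    linarith
  have hTD2 : T * D ≤ 81 / 128 := by
    have := mul_le_mul_of_nonneg_left hsym.2 hT0.le
    linarith
  have hD0 : 0 ≤ D := by
    refine le_trans ?_ hsym.1
    have : (0 : ℝ) < q := Int.cast_pos.2 hq
    positivity
  have htD1 : T / 2 * D ≤ t * D := mul_le_mul_of_nonneg_right ht.1 hD0
  have htD2 : t * D ≤ T * D := mul_le_mul_of_nonneg_right ht.2 hD0
  have hγlow : 1 - q * mesh M ≤ ‖γ‖ := by
    have := norm_sub_norm_le 1 γ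
    rw [norm_one, norm_sub_rev] at this
    linarith
  have hg0 : 0 ≤ 1 - ‖γ‖ ^ 2 := by nlinarith [norm_nonneg γ]
  have hg1 : 1 - ‖γ‖ ^ 2 ≤ 1 / 25000 := by nlinarith [norm_nonneg γ]
  have hA2 : A ^ 2 ≤ 1 := pow_le_one₀ hA.1 hA.2
  have ht0 : 0 ≤ t := by linarith [ht.1]
  -- The nonlinear phases differ only through `|γ| < 1`; for `T ≤ 1` this is negligible against
  -- `1/1280`, whatever the sign of `μ`.
  have hN : |t * (μ * (A ^ 2 * (1 - ‖γ‖ ^ 2)))| ≤ 1 / 25000 := by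
    rw [abs_mul, abs_mul, hμ, one_mul, abs_of_nonneg ht0,
      abs_of_nonneg (mul_nonneg (sq_nonneg A) hg0)]
    calc t * (A ^ 2 * (1 - ‖γ‖ ^ 2)) ≤ 1 * (1 * (1 / 25000)) := by
          gcongr; exact ht.2.trans hT1
      _ = _ := by norm_num
  have heq : -(t * (latticeSymbol α M q + μ * ‖(A : ℂ) * γ‖ ^ 2)) -
      -(t * (|(q : ℝ)| ^ α + μ * ‖(A : ℂ)‖ ^ 2)) =
        t * D + t * (μ * (A ^ 2 * (1 - ‖γ‖ ^ 2))) := by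
    rw [norm_mul, Complex.norm_real, Real.norm_of_nonneg hA.1, hD]; ring
  rw [heq]
  have := abs_le.1 hN
  constructor <;> linarith

end FDNLS

/-! ### Choice of constants and conclusion -/

theorem mainTheorem2 (α : ℝ) (hα : α ∈ Set.Ioc (1 : ℝ) 2) :
    ∃ T₀ > (0 : ℝ), ∃ K > (0 : ℝ), ∀ T ∈ Set.Ioc 0 T₀, ∃ c > (0 : ℝ), ∃ h₀ > (0 : ℝ),
      ∀ μ : ℝ, (μ = 1 ∨ μ = -1) → ∀ (M : ℕ) [NeZero M], FDNLS.mesh M < h₀ →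
        ∃ u₀ : FDNLS.L2,
          FDNLS.MemSobolev (α / 2) u₀ ∧ FDNLS.sobolevNorm (α / 2) u₀ ≤ K ∧
          (∀ k : ℤ, k ≠ round ((T * FDNLS.mesh M ^ 2) ^ (-(1 / (2 + α)))) →
            FDNLS.fourierHat u₀ k = 0) ∧
          ∃ (u : ℝ → FDNLS.L2) (w : ℝ → FDNLS.LatticeFun M),
            FDNLS.IsSolution α μ T u₀ u ∧
            (∀ v, FDNLS.IsSolution α μ T u₀ v → Set.EqOn v u (Set.Icc 0 T)) ∧
            FDNLS.IsLatticeSolution α μ T M (FDNLS.discretize M u₀) w ∧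
            (∀ v, FDNLS.IsLatticeSolution α μ T M (FDNLS.discretize M u₀) v →
              Set.EqOn v w (Set.Icc 0 T)) ∧
            ENNReal.ofReal (c * FDNLS.mesh M ^ (α / (2 + α))) ≤ FDNLS.errorNorm T M w u := by
  -- `T₀ = 1` keeps the nonlinear phase shift small; `√(2π)` is the exact `H^{α/2}` norm of the
  -- datum.
  refine ⟨1, one_pos, √(2 * π), by positivity, fun T hT => ?_⟩
  have hT0 : 0 < T := hT.1
  obtain ⟨h₀, hh₀, H⟩ := FDNLS.exists_mesh_threshold hα.1 hT0 (ε := 1 / 100000) (by norm_num)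
  -- `32000 = 4 · 8000`: the losses in `amplitude_lower_bound` and `le_amplitude_gap`.
  refine ⟨T ^ (α / (2 * (2 + α))) / 32000, by positivity, h₀, hh₀, fun μ hμ M _ hM => ?_⟩
  have hh := FDNLS.mesh_pos M
  obtain ⟨hκ, hhκ⟩ := H _ hh hM
  set q : ℤ := round ((T * FDNLS.mesh M ^ 2) ^ (-(1 / (2 + α)))) with hqdef
  have hκq : |(T * FDNLS.mesh M ^ 2) ^ (-(1 / (2 + α))) - q| ≤ 1 / 2 := abs_sub_round _
  have hκq' := abs_le.1 hκq
  have hq' : (0 : ℝ) < q := by linarith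
  have hq : 0 < q := Int.cast_pos.1 hq'
  have hη : (q : ℝ) * FDNLS.mesh M ≤ 1 / 50000 := by nlinarith
  -- Since `qh` is far below `π = Mh`, the lattice resolves the frequency `q`.
  have hqM : q ∈ Finset.Ico (-(M : ℤ)) M := by
    have hlt : (q : ℝ) < M := by
      have hMπ := FDNLS.mesh_mul_cast M
      refine lt_of_mul_lt_mul_right (a := FDNLS.mesh M) ?_ hh.le
      linarith [Real.pi_gt_three]
    have : q < M := by exact_mod_cast hlt
    rw [Finset.mem_Ico]; omega
  set A : ℝ := (1 + (q : ℝ) ^ 2) ^ (-(α / 4)) with hAdef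
  have hA0 : 0 ≤ A := by positivity
  have hA1 : A ≤ 1 := Real.rpow_le_one_of_one_le_of_nonpos (by nlinarith) (by linarith [hα.1])
  have hAn : ‖(A : ℂ)‖ = A := by rw [Complex.norm_real, Real.norm_of_nonneg hA0]
  set γ : ℂ := FDNLS.cellAverage M q
  have hγ : ‖γ‖ ≤ 1 := FDNLS.norm_cellAverage_le M q
  have hγ1 : ‖γ - 1‖ ≤ q * FDNLS.mesh M := by
    have := FDNLS.norm_cellAverage_sub_one_le M q
    rwa [abs_of_pos hq'] at this
  have hsol := FDNLS.isSolution_planeWave α μ T (A : ℂ) q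
  have hlat := FDNLS.isLatticeSolution_planeWave α μ T M ((A : ℂ) * γ) hqM
  rw [← FDNLS.discretize_smul_fourierLp] at hlat
  refine ⟨(A : ℂ) • (fourierLp 2 q : FDNLS.L2), FDNLS.memSobolev_smul_fourierLp _ _ _, ?_,
    fun k hk => by rw [FDNLS.fourierHat_smul_fourierLp, if_neg hk], _, _, hsol,
    fun v hv => hv.eqOn hα.1 hsol, hlat, fun v hv => hv.eqOn hlat, ?_⟩
  · rw [FDNLS.sobolevNorm_smul_fourierLp, hAn, Real.sqrt_mul (by positivity), mul_assoc,
      Real.sqrt_eq_rpow ((1 + (q : ℝ) ^ 2) ^ (α / 2)), ← Real.rpow_mul (by positivity), hAdef,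
      ← Real.rpow_add (by positivity), show α / 2 * (1 / 2) + -(α / 4) = 0 by ring,
      Real.rpow_zero, mul_one]
  · have hAlow := FDNLS.amplitude_lower_bound hα hT0 hh hκ hκq
    rw [← hAdef] at hAlow
    refine (ENNReal.ofReal_le_ofReal (?_ : _ ≤ A / 8000)).trans
      (FDNLS.ofReal_le_errorNorm hT0 (by positivity) M fun t ht => ?_)
    · linarith
    have hμ1 : |μ| = 1 := by rcases hμ with rfl | rfl <;> simp
    have hphase := FDNLS.phase_bounds (γ := γ) hα hT hμ1 M hq hκ hκq hη ⟨hA0, hA1⟩ hγ hγ1 ht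
    filter_upwards [FDNLS.coeFn_smul_fourierLp ((A : ℂ) *
      Complex.exp (Complex.I * ((-(t * (|(q : ℝ)| ^ α + μ * ‖(A : ℂ)‖ ^ 2)) : ℝ) : ℂ))) q] with x hx
    rw [hx]
    refine (FDNLS.le_amplitude_gap hA0 hγ ?_ ?_ hphase).trans
      (FDNLS.le_norm_interpolate_sub M q _ _ x) <;> rwa [abs_of_pos hq']
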